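/- Let $p$ be a prime, let $k,n\ge 1$ be integers, let $c\ge 1$ be real, and let $A=\mathbb Z_{p^k}^n$, with character group $A^*=\mathrm{Hom}(A,\mathbb C^\times)$. A probability distribution on a finite set $S$ is called nearly uniform with tolerance $c$ over $S'\subseteq S$ if $\Pr(s)=0$ for $s\in S\setminus S'$ and $\frac{1}{c|S'|}\le \Pr(s)\le \frac{c}{|S'|}$ for $s\in S'$. The decision version of Random Linear Disequations$(A,c)$ is the following problem: given access to independent samples from a distribution on $A^*$ which, with tolerance $c$, is either (i) nearly uniform over $\{\chi\in A^* : \chi(u)\neq 1\}$ for some fixed unknown $u\in A$, or (ii) nearly uniform over the whole of $A^*$, decide which is the case. A character $\chi$ is given by its coordinates $x_1,\dots,x_n\in\{0,\dots,p^k-1\}$, where $\chi(b_i)=\zeta^{x_i}$ for a fixed basis $b_1,\dots,b_n$ of $A$ and a fixed primitive $p^k$-th root of unity $\zeta\in\mathbb C$. Time is the number of steps of a random access machine whose words have length logarithmic in the running time; reading one coordinate of a sample is one step. **Theorem.** There are an absolute constant $K$ and a single algorithm, which receives $p,k,n,\lceil c\rceil$ and the stream of samples and uses no other randomness, such that for all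 primes $p$, all integers $k,n\ge 1$ and all real $c\ge 1$: - for every sequence of samples it halts with an answer within $c\,(pnk)^{K(2p)^k}$ steps, that is, in time $c\,(pnk)^{O((2p)^k)}$; - in case (i) its answer is correct with probability $1$; - in case (ii) its answer is correct with probability at least $2/3$. So the error is one-sided and at most $1/3$. In particular, for every fixed prime power $p^k$ and every fixed $c$, there is a polynomial in $n$ which bounds the running time for all $n\ge 1$. -/

import Mathlib

namespace RandomLinearDisequations

/-! ### Machine model

A random access machine over the natural numbers with a stream of inputs and structured
control flow. -/

/-- Binary operations of the machine; subtraction is truncated, division rounds down, and the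
comparisons return `1` or `0`. -/
inductive Op where
  | add | sub | mul | div | mod | lt | eq

/-- The value of an operation. -/
def Op.value : Op → ℕ → ℕ → ℕ
  | .add, x, y => x + y
  | .sub, x, y => x - y
  | .mul, x, y => x * y
  | .div, x, y => x / y
  | .mod, x, y => x % y
  | .lt, x, y => if x < y then 1 else 0
  | .eq, x, y => if x = y then 1 else 0

/-- The cost of an operation: one step, plus the amount by which the result exceeds the larger
operand. As all other instructions have unit cost and create no new numbers (apart from the
constants of the program and the numbers read), a number in memory never exceeds the sum of
the running time and the largest number given to the machine: the machine works
with words whose length is logarithmic in the running time, and large numbers cannot be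
created cheaply. -/
def Op.cost (o : Op) (x y : ℕ) : ℕ := 1 + (o.value x y - max x y)

/-- Programs. Below `X r` is the content of register `r`. -/
inductive Prog where
  /-- do nothing -/
  | skip : Prog
  /-- `X r := v` for a constant `v` -/
  | const (r v : ℕ) : Prog
  /-- `X r := X a` -/
  | copy (r a : ℕ) : Prog
  /-- `X r := o (X a) (X b)` -/
  | op (o : Op) (r a b : ℕ) : Prog
  /-- `X r := X (X a)` -/
  | load (r a : ℕ) : Prog
  /-- `X (X r) := X a` -/
  | store (r a : ℕ) : Prog
  /-- `X r :=` the next number of the input stream -/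
  | read (r : ℕ) : Prog
  /-- first `P`, then `Q` -/
  | seq (P Q : Prog) : Prog
  /-- if `X r ≠ 0` then `P` else `Q` -/
  | ite (r : ℕ) (P Q : Prog) : Prog
  /-- while `X r ≠ 0` do `P` -/
  | while (r : ℕ) (P : Prog) : Prog

/-- A state: the contents of the registers and the number of inputs read so far. -/
structure State where
  mem : ℕ → ℕ
  pos : ℕ

/-- The state after assigning `v` to register `r`. -/
def State.set (s : State) (r v : ℕ) : State := ⟨Function.update s.mem r v, s.pos⟩

/-- `Exec input P s s' t`: with the input stream `input`, the program `P` started in state `s`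
halts in state `s'` after exactly `t` steps. -/
inductive Exec (input : ℕ → ℕ) : Prog → State → State → ℕ → Prop where
  | skip (s : State) : Exec input .skip s s 1
  | const (r v : ℕ) (s : State) : Exec input (.const r v) s (s.set r v) 1
  | copy (r a : ℕ) (s : State) : Exec input (.copy r a) s (s.set r (s.mem a)) 1
  | op (o : Op) (r a b : ℕ) (s : State) :
      Exec input (.op o r a b) s (s.set r (o.value (s.mem a) (s.mem b)))
        (o.cost (s.mem a) (s.mem b))
  | load (r a : ℕ) (s : State) : Exec input (.load r a) s (s.set r (s.mem (s.mem a))) 1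
  | store (r a : ℕ) (s : State) : Exec input (.store r a) s (s.set (s.mem r) (s.mem a)) 1
  | read (r : ℕ) (s : State) :
      Exec input (.read r) s ⟨Function.update s.mem r (input s.pos), s.pos + 1⟩ 1
  | seq {P Q : Prog} {s s' s'' : State} {t t' : ℕ} :
      Exec input P s s' t → Exec input Q s' s'' t' → Exec input (.seq P Q) s s'' (t + t')
  | ite_true {r : ℕ} {P Q : Prog} {s s' : State} {t : ℕ} :
      s.mem r ≠ 0 → Exec input P s s' t → Exec input (.ite r P Q) s s' (1 + t)
  | ite_false {r : ℕ} {P Q : Prog} {s s' : State} {t : ℕ} :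
      s.mem r = 0 → Exec input Q s s' t → Exec input (.ite r P Q) s s' (1 + t)
  | while_true {r : ℕ} {P : Prog} {s s' s'' : State} {t t' : ℕ} :
      s.mem r ≠ 0 → Exec input P s s' t → Exec input (.while r P) s' s'' t' →
        Exec input (.while r P) s s'' (1 + t + t')
  | while_false {r : ℕ} {P : Prog} {s : State} :
      s.mem r = 0 → Exec input (.while r P) s s 1

/-- The initial memory: the parameters in registers `0`, `1`, `2`, `3`, and zeros elsewhere. -/
def initMem (p k n c : ℕ) : ℕ → ℕ
  | 0 => p
  | 1 => k
  | 2 => n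
  | 3 => c
  | _ => 0

/-- With parameters `p`, `k`, `n`, `c` and the given input stream, the program `P` halts after
exactly `t` steps with output (the content of register `0`) equal to `out`. -/
def Runs (P : Prog) (p k n c : ℕ) (input : ℕ → ℕ) (out t : ℕ) : Prop :=
  ∃ s : State, Exec input P ⟨initMem p k n c, 0⟩ s t ∧ s.mem 0 = out

/-! ### Characters and their distributions -/

/-- The group `A = (ℤ / p ^ k) ^ n`. -/
abbrev Grp (p k n : ℕ) : Type := Fin n → ZMod (p ^ k)

/-- The characters of `A`: homomorphisms to the multiplicative group of `ℂ`. -/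
abbrev Chars (p k n : ℕ) : Type := AddChar (Grp p k n) ℂ

/-- Every set of characters is measurable. -/
instance (p k n : ℕ) : MeasurableSpace (Chars p k n) := ⊤

/-- The distribution `μ` on the finite set `S` is nearly uniform over `S'` with tolerance `c`. -/
def NearlyUniformOn {S : Type*} [Finite S] (c : ℝ) (μ : PMF S) (S' : Set S) : Prop :=
  (∀ s, s ∉ S' → μ s = 0) ∧
    ∀ s ∈ S', 1 / (c * (S'.ncard : ℝ)) ≤ (μ s).toReal ∧ (μ s).toReal ≤ c / (S'.ncard : ℝ)

/-- The `i`-th coordinate of the character `χ` with respect to a basis `b` of `A` and a primitive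
`p ^ k`-th root of unity `ζ`: the number `x` in `{0, …, p ^ k - 1}` with `χ (b i) = ζ ^ x`. -/
noncomputable def charCoord {p k n : ℕ} (ζ : ℂ)
    (b : Module.Basis (Fin n) (ZMod (p ^ k)) (Grp p k n)) (χ : Chars p k n) (i : Fin n) : ℕ :=
  sInf {x : ℕ | χ (b i) = ζ ^ x}

/-- The input stream of the machine for a sequence of sampled characters: the `n` coordinates of
the first one, then the `n` coordinates of the second one, and so on. -/
noncomputable def charStream {p k n : ℕ} [NeZero n] (ζ : ℂ)
    (b : Module.Basis (Fin n) (ZMod (p ^ k)) (Grp p k n)) (s : ℕ → Chars p k n) (j : ℕ) : ℕ :=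
  charCoord ζ b (s (j / n)) (Fin.ofNat n j)

/-- The law of a sequence of independent characters, each with distribution `μ`. -/
noncomputable def sampleLaw {p k n : ℕ} (μ : PMF (Chars p k n)) :
    MeasureTheory.Measure (ℕ → Chars p k n) :=
  MeasureTheory.Measure.infinitePi fun _ => μ.toMeasure

/-- The program `P` solves the decision version of Random Linear Disequations over
`(ℤ / p ^ k) ^ n` with tolerance `c` in time `T`, with one-sided error `1/3`.
It receives `p`, `k`, `n`, `⌈c⌉` and the stream of independent samples (coordinates with respect to
any basis of the group and any primitive `p ^ k`-th root of unity), and halts within `T` steps for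
all samples. Output `0` stands for "characters not containing some `u` in their kernels" and
output `1` for "all characters". In the first case the answer is right with probability `1`, and
in the second case with probability at least `2/3`. -/
def DecidesInTime (P : Prog) (p k n : ℕ) [Fact p.Prime] [NeZero n] (c T : ℝ) : Prop :=
  ∀ (ζ : ℂ) (b : Module.Basis (Fin n) (ZMod (p ^ k)) (Grp p k n)), IsPrimitiveRoot ζ (p ^ k) →
    (∀ s : ℕ → Chars p k n,
      ∃ out t : ℕ, Runs P p k n ⌈c⌉₊ (charStream ζ b s) out t ∧ (t : ℝ) ≤ T) ∧
    ∀ μ : PMF (Chars p k n),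
      ((∃ u : Grp p k n, NearlyUniformOn c μ {χ | χ u ≠ 1}) →
        sampleLaw μ {s | ∃ t, Runs P p k n ⌈c⌉₊ (charStream ζ b s) 0 t} = 1) ∧
      (NearlyUniformOn c μ Set.univ →
        2 / 3 ≤ sampleLaw μ {s | ∃ t, Runs P p k n ⌈c⌉₊ (charStream ζ b s) 1 t})

end RandomLinearDisequations

/-! Write the coordinates of a character in base `p`. This identifies the characters with the points
of `F_p^m`, `m = n * k`. Put `D = p ^ k - 1`. Samples are tested against polynomials of degree at
most `D` in these digits.

Case (i). If `χ(u) = ζ ^ E`, then `E` is, after choosing representatives, a nonnegative integer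
combination of the digits. The function `(E + D).choose D` mod `p` vanishes unless `p ^ k ∣ E`,
takes the value `1` at the trivial character, and has degree at most `D` in the digits
(`charDigits_indicator`). So some polynomial of degree at most `D` with nonzero constant term
vanishes at every possible sample. Its coefficient vector is the witness of `HasWitness`.

Case (ii). A polynomial of degree at most `D` with nonzero constant term is nonzero on at least a
fraction `2 ^ (-D)` of all points (`card_le_two_pow_mul_card_support`), so each sample refutes it
with probability at least `1 / (c * 2 ^ D)`. There are at most `p ^ N` candidates, `N = (m + 1) ^
D`, and a union bound shows that `R = ⌈c⌉ * 2 ^ D * (N * p + 2)` samples refute all of them, up to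
error `exp (-2) < 1/3` (`two_thirds_le_sampleLaw`).

Algorithm. Whether a witness exists is linear algebra over `F_p`. The program keeps `N` vectors
spanning the forms that vanish on the samples seen so far, and cuts this span down by one
elimination step per sample (`mem_span_eliminate_iff`). It answers `0` exactly when some spanning
vector has a nonzero constant coefficient. A small program logic for the machine gives correctness
and running time together. -/

namespace RandomLinearDisequations

/-! ### Functions of bounded degree on a finite group -/

section Degree

variable {G F : Type*} [AddCommGroup G] [Field F]

/-- The difference of `f` in direction `h`. -/
def diff (h : G) (f : G → F) : G → F := fun x => f (x + h) - f x

/-- Twisted Leibniz rule: the difference of `a * l` is the difference of `a` times a translate of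
`l`, plus `a` times the difference of `l`. Thus, with `S` playing the role of the affine functions,
differencing lowers the degree by one. -/
theorem diff_mem_pow {S : Submodule F (G → F)} (hS : ∀ l ∈ S, ∀ h, (fun x => l (x + h)) ∈ S)
    (hd : ∀ l ∈ S, ∀ h, diff h l ∈ (1 : Submodule F (G → F))) (h : G) (D : ℕ) :
    ∀ f ∈ S ^ (D + 1), diff h f ∈ S ^ D := by
  induction D with
  | zero => intro f hf; rw [zero_add, pow_one] at hf; simpa using hd f hf h
  | succ D ih =>
    intro f hf
    rw [pow_succ] at hf
    induction hf using Submodule.mul_induction_on' with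
    | mem_mul_mem a ha l hl =>
      have e : diff h (a * l) = diff h a * (fun x => l (x + h)) + a * diff h l := by
        ext x; simp [diff]; ring
      rw [e]
      refine Submodule.add_mem _ ?_ ?_
      · rw [pow_succ]; exact Submodule.mul_mem_mul (ih a ha) (hS l hl h)
      · simpa using Submodule.mul_mem_mul ha (hd l hl h)
    | add a _ b _ ha hb =>
      have e : diff h (a + b) = diff h a + diff h b := by
        ext x; simp [diff]; ring
      rw [e]
      exact Submodule.add_mem _ ha hb

/-- Induction on the degree: a nonconstant `f` has some nonzero difference, of smaller degree, whose
support is at most twice as large as that of `f`. -/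
theorem card_le_two_pow_mul_card_support [Fintype G] [DecidableEq F] {S : Submodule F (G → F)}
    (hS : ∀ l ∈ S, ∀ h, (fun x => l (x + h)) ∈ S)
    (hd : ∀ l ∈ S, ∀ h, diff h l ∈ (1 : Submodule F (G → F))) (D : ℕ) :
    ∀ f ∈ S ^ D, f ≠ 0 → Fintype.card G ≤ 2 ^ D * (Finset.univ.filter fun x => f x ≠ 0).card := by
  have const : ∀ f : G → F, f ≠ 0 → (∀ x y, f x = f y) → ∀ D : ℕ,
      Fintype.card G ≤ 2 ^ D * (Finset.univ.filter fun x => f x ≠ 0).card := by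
    intro f hf hc D
    obtain ⟨x, hx⟩ := Function.ne_iff.1 hf
    have : (Finset.univ.filter fun x => f x ≠ 0) = Finset.univ := by
      ext y; simpa [hc y x] using hx
    rw [this, Finset.card_univ]
    exact Nat.le_mul_of_pos_left _ (by positivity)
  induction D with
  | zero =>
    intro f hf hf0
    refine const f hf0 ?_ 0
    rw [pow_zero, Submodule.mem_one] at hf
    obtain ⟨c, rfl⟩ := hf
    intro x y; rfl
  | succ D ih =>
    intro f hf hf0
    by_cases h0 : ∀ h, diff h f = 0
    · refine const f hf0 (fun x y => ?_) _
      have := congrFun (h0 (x - y)) y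
      simpa [diff, sub_eq_zero] using this
    · push Not at h0
      obtain ⟨h, hh⟩ := h0
      refine (ih _ (diff_mem_pow hS hd h D f hf) hh).trans ?_
      rw [pow_succ, mul_assoc]
      refine Nat.mul_le_mul_left _ ?_
      classical
      set A := Finset.univ.filter fun x => f x ≠ 0
      -- If `f (x + h) - f x ≠ 0`, then `x` lies in the support of `f` or in its translate by `-h`.
      have : (Finset.univ.filter fun x => diff h f x ≠ 0) ⊆
          A ∪ A.map (Equiv.subRight h).toEmbedding := by
        intro x hx
        have hx : f (x + h) - f x ≠ 0 := (Finset.mem_filter.1 hx).2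
        by_cases h1 : f x = 0
        · refine Finset.mem_union_right _ (Finset.mem_map.2 ⟨x + h, ?_, by simp⟩)
          simpa [A, h1] using hx
        · exact Finset.mem_union_left _ (by simp [A, h1])
      refine (Finset.card_le_card this).trans ((Finset.card_union_le _ _).trans ?_)
      rw [Finset.card_map]; omega

end Degree

/-! ### Monomials indexed by numbers written in base `M` -/

section Monomials

variable {X F : Type*} [Field F]

/-- The `t`-th product of `D` of the functions `y 0, …, y (M - 1)`. -/
def monomial (y : ℕ → X → F) (M D t : ℕ) : X → F := ∏ l ∈ Finset.range D, y (t / M ^ l % M)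

theorem monomial_succ (y : ℕ → X → F) {M D t s : ℕ} (hs : s < M) :
    monomial y M (D + 1) (t * M + s) = monomial y M D t * y s := by
  have hM : 0 < M := by omega
  have h1 : (t * M + s) / M = t := by
    rw [add_comm, Nat.add_mul_div_right _ _ hM, Nat.div_eq_of_lt hs, zero_add]
  rw [monomial, Finset.prod_range_succ']
  congr 1
  · refine Finset.prod_congr rfl fun l _ => ?_
    rw [pow_succ', ← Nat.div_div_eq_div_mul, h1]
  · rw [pow_zero, Nat.div_one, Nat.mul_add_mod_self_right, Nat.mod_eq_of_lt hs]

theorem monomial_mem (y : ℕ → X → F) {M : ℕ} (hM : 0 < M) (D t : ℕ) :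
    monomial y M D t ∈ (Submodule.span F (y '' Set.Iio M)) ^ D := by
  unfold monomial
  induction D with
  | zero => simpa [Submodule.mem_one] using ⟨1, map_one _⟩
  | succ D ih =>
    rw [Finset.prod_range_succ, pow_succ]
    exact Submodule.mul_mem_mul ih (Submodule.subset_span ⟨_, Nat.mod_lt _ hM, rfl⟩)

/-- Products of `D` generators are listed as ordered tuples, the base `M` digits of `t`. The
repetitions among them are harmless: only spanning is needed, and the indexing is easy to compute.
-/
theorem exists_eq_sum_monomial (y : ℕ → X → F) (M D : ℕ) (g : X → F)
    (hg : g ∈ (Submodule.span F (y '' Set.Iio M)) ^ D) :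
    ∃ w : ℕ → F, g = ∑ t ∈ Finset.range (M ^ D), w t • monomial y M D t := by
  have key : (Submodule.span F (y '' Set.Iio M)) ^ D ≤
      Submodule.span F (Set.range fun t : Fin (M ^ D) => monomial y M D t) := by
    clear hg
    induction D with
    | zero =>
      rw [pow_zero, Submodule.one_eq_span]
      refine Submodule.span_mono ?_
      rintro _ rfl
      exact ⟨⟨0, by simp⟩, by simp [monomial]⟩
    | succ D ih =>
      rw [pow_succ]
      refine (mul_le_mul' ih le_rfl).trans ?_
      rw [Submodule.span_mul_span]
      refine Submodule.span_mono ?_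
      rintro _ ⟨_, ⟨t, rfl⟩, _, ⟨s, hs, rfl⟩, rfl⟩
      refine ⟨⟨t * M + s, ?_⟩, monomial_succ y hs⟩
      have := t.2
      have hs : s < M := hs
      rw [pow_succ]
      nlinarith
  obtain ⟨c, hc⟩ := (Submodule.mem_span_range_iff_exists_fun F).1 (key hg)
  refine ⟨fun t => if h : t < M ^ D then c ⟨t, h⟩ else 0, ?_⟩
  rw [← hc, Finset.sum_range]
  refine Finset.sum_congr rfl fun i _ => ?_
  simp

end Monomials

/-! ### Binomial coefficients as functions of digits -/

section Digits

open Polynomial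

variable {X : Type*} {p : ℕ} [Fact p.Prime] {S : Submodule (ZMod p) (X → ZMod p)}

theorem one_le_pow_of_one_mem (h1 : 1 ∈ S) {a b : ℕ} (hab : a ≤ b) : S ^ a ≤ S ^ b :=
  pow_le_pow_right' (by rw [Submodule.one_le]; exact h1) hab

theorem const_mem_pow (h1 : 1 ∈ S) (c : ZMod p) (b : ℕ) : (fun _ : X => c) ∈ S ^ b := by
  refine one_le_pow_of_one_mem h1 (Nat.zero_le b) ?_
  rw [pow_zero, Submodule.mem_one]
  exact ⟨c, rfl⟩

/-- Recursion `(s + 1) * d.choose (s + 1) = d.choose s * (d - s)`, in which `s + 1` is invertible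
because it is smaller than `p`. -/
theorem choose_val_mem_pow (h1 : 1 ∈ S) {d : X → ZMod p} (hd : d ∈ S) (s : ℕ) (hs : s < p) :
    (fun x => ((d x).val.choose s : ZMod p)) ∈ S ^ s := by
  induction s with
  | zero => simpa using const_mem_pow h1 (1 : ZMod p) 0
  | succ s ih =>
    have h0 : ((s + 1 : ℕ) : ZMod p) ≠ 0 := by
      rw [Ne, ZMod.natCast_eq_zero_iff]
      exact Nat.not_dvd_of_pos_of_lt (Nat.succ_pos _) hs
    have e : (fun x => ((d x).val.choose (s + 1) : ZMod p)) =
        ((s + 1 : ℕ) : ZMod p)⁻¹ • ((fun x => ((d x).val.choose s : ZMod p)) *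
          (d - fun _ => (s : ZMod p))) := by
      ext x
      have := congrArg (Nat.cast : ℕ → ZMod p) (Nat.choose_succ_right_eq (d x).val s)
      simp only [Pi.smul_apply, Pi.mul_apply, Pi.sub_apply, smul_eq_mul]
      rw [eq_inv_mul_iff_mul_eq₀ h0, mul_comm, ← Nat.cast_mul, this]
      rcases le_or_gt s (d x).val with h | h
      · rw [Nat.cast_mul, Nat.cast_sub h, ZMod.natCast_zmod_val]
      · simp [Nat.choose_eq_zero_of_lt h]
    rw [e, pow_succ]
    refine Submodule.smul_mem _ _ (Submodule.mul_mem_mul (ih (by omega)) (sub_mem hd ?_))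
    simpa using const_mem_pow h1 (s : ZMod p) 1

/-- The coefficient of `T ^ r` depends on the point by a function of degree at most `r`. -/
def Graded (S : Submodule (ZMod p) (X → ZMod p)) (Q : X → (ZMod p)[X]) : Prop :=
  ∀ r, (fun x => (Q x).coeff r) ∈ S ^ r

theorem Graded.mul {Q Q' : X → (ZMod p)[X]} (h : Graded S Q) (h' : Graded S Q') :
    Graded S (fun x => Q x * Q' x) := by
  intro r
  have e : (fun x => (Q x * Q' x).coeff r) = ∑ ij ∈ Finset.HasAntidiagonal.antidiagonal r,
      (fun x => (Q x).coeff ij.1) * (fun x => (Q' x).coeff ij.2) := by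
    ext x; simp [coeff_mul]
  rw [e]
  refine Submodule.sum_mem _ fun ij hij => ?_
  rw [← Finset.HasAntidiagonal.mem_antidiagonal.1 hij, pow_add]
  exact Submodule.mul_mem_mul (h _) (h' _)

theorem Graded.const (h1 : 1 ∈ S) (q : (ZMod p)[X]) : Graded S fun _ => q :=
  fun r => const_mem_pow h1 _ r

/-- With `q = (1 + T) ^ a - 1`, expand `(1 + q) ^ d` binomially. The coefficient of `q ^ s` has
degree `s` in the digit `d`, and `T ^ s ∣ q ^ s`, so only `s ≤ r` contribute to the coefficient of
`T ^ r`. As `d < p`, only `s < p` occur. -/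
theorem Graded.pow_val (h1 : 1 ∈ S) {d : X → ZMod p} (hd : d ∈ S) (a : ℕ) :
    Graded S fun x => (1 + Polynomial.X) ^ (a * (d x).val) := by
  intro r
  set q : (ZMod p)[X] := (1 + Polynomial.X) ^ a - 1
  have hq : Polynomial.X ∣ q := by
    rw [X_dvd_iff]; simp [q, coeff_zero_eq_eval_zero]
  have e : (fun x => ((1 + Polynomial.X : (ZMod p)[X]) ^ (a * (d x).val)).coeff r) =
      ∑ s ∈ Finset.range p, (q ^ s).coeff r • fun x => ((d x).val.choose s : ZMod p) := by
    ext x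
    have h2 : (1 + Polynomial.X : (ZMod p)[X]) ^ (a * (d x).val) =
        ∑ s ∈ Finset.range p, q ^ s * ((d x).val.choose s : (ZMod p)[X]) := by
      rw [pow_mul, show (1 + Polynomial.X : (ZMod p)[X]) ^ a = q + 1 by simp [q], add_pow]
      simp only [one_pow, mul_one]
      refine Finset.sum_subset (Finset.range_mono (ZMod.val_lt (d x))) fun s _ hs => ?_
      rw [Finset.mem_range, not_lt] at hs
      simp [Nat.choose_eq_zero_of_lt (show (d x).val < s by omega)]
    rw [h2]
    simp only [finsetSum_coeff, coeff_mul_natCast, Finset.sum_apply, Pi.smul_apply, smul_eq_mul]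
  rw [e]
  refine Submodule.sum_mem _ fun s hs => ?_
  rcases le_or_gt s r with h | h
  · exact Submodule.smul_mem _ _ (one_le_pow_of_one_mem h1 h
      (choose_val_mem_pow h1 hd s (Finset.mem_range.1 hs)))
  · rw [X_pow_dvd_iff.1 (pow_dvd_pow_of_dvd hq s) r h, zero_smul]
    exact Submodule.zero_mem _

/-- The binomial coefficient is the coefficient of `T ^ q` in a product of powers of `1 + T`, one
for each digit and one constant. The degree bound is therefore `q`, independently of the weights `a
i`. -/
theorem choose_sum_mem_pow {ι : Type*} (h1 : 1 ∈ S) (I : Finset ι) (d : ι → X → ZMod p)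
    (hd : ∀ i, d i ∈ S) (a : ι → ℕ) (q : ℕ) :
    (fun x => (((∑ i ∈ I, a i * (d i x).val) + q).choose q : ZMod p)) ∈ S ^ q := by
  have h : Graded S fun x => ∏ i ∈ I, (1 + Polynomial.X) ^ (a i * (d i x).val) := by
    classical
    induction I using Finset.induction_on with
    | empty => simpa using Graded.const h1 1
    | insert i I hi ih =>
      simp only [Finset.prod_insert hi]
      exact (Graded.pow_val h1 (hd i) (a i)).mul ih
  have := (h.mul (Graded.const h1 ((1 + Polynomial.X) ^ q))) q
  simpa only [Finset.prod_pow_eq_pow_sum, ← pow_add, coeff_one_add_X_pow] using this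

/-- With `q = p ^ k - 1`, the identity `p ^ k * (m + q).choose (p ^ k) = m * (m + q).choose q`
forces `p ^ k ∣ m` as soon as `p` does not divide the last factor. -/
theorem choose_eq_zero_of_not_dvd {k m : ℕ} (h : ¬ p ^ k ∣ m) :
    ((m + (p ^ k - 1)).choose (p ^ k - 1) : ZMod p) = 0 := by
  have hp : p.Prime := Fact.out
  rw [ZMod.natCast_eq_zero_iff]
  by_contra hc
  apply h
  have e := Nat.choose_succ_right_eq (m + (p ^ k - 1)) (p ^ k - 1)
  rw [Nat.sub_add_cancel (Nat.one_le_pow _ _ hp.pos), Nat.add_sub_cancel] at e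
  exact (((hp.coprime_iff_not_dvd).2 hc).pow_left k).dvd_of_dvd_mul_left
    (e ▸ Dvd.intro_left _ rfl)

end Digits

/-! ### Polynomials in the digits of the coordinates of a character -/

section DigitFunctions

variable {p m : ℕ} [Fact p.Prime]

/-- The constant function `1`, followed by the `m` coordinate functions. -/
def digitFun (p m : ℕ) : ℕ → (Fin m → ZMod p) → ZMod p
  | 0, _ => 1
  | s + 1, d => if h : s < m then d ⟨s, h⟩ else 0

/-- The span of the constant function `1` and the coordinate functions. -/
abbrev digitSpan (p m : ℕ) [Fact p.Prime] : Submodule (ZMod p) ((Fin m → ZMod p) → ZMod p) :=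
  Submodule.span (ZMod p) (digitFun p m '' Set.Iio (m + 1))

theorem one_mem_digitSpan : 1 ∈ digitSpan p m :=
  Submodule.subset_span ⟨0, Nat.succ_pos _, rfl⟩

theorem proj_mem_digitSpan (s : Fin m) : (fun d => d s) ∈ digitSpan p m := by
  refine Submodule.subset_span ⟨s + 1, Nat.succ_lt_succ s.2, ?_⟩
  ext d
  simp [digitFun]

theorem diff_mem_one_of_mem_digitSpan (l : (Fin m → ZMod p) → ZMod p) (hl : l ∈ digitSpan p m)
    (h : Fin m → ZMod p) : diff h l ∈ (1 : Submodule (ZMod p) ((Fin m → ZMod p) → ZMod p)) := by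
  induction hl using Submodule.span_induction with
  | mem x hx =>
    obtain ⟨s, hs, rfl⟩ := hx
    rw [Submodule.mem_one]
    cases s with
    | zero => exact ⟨0, by ext d; simp [diff, digitFun]⟩
    | succ s =>
      have hs : s < m := Nat.lt_of_succ_lt_succ hs
      exact ⟨h ⟨s, hs⟩, by ext d; simp [diff, digitFun, hs]⟩
  | zero =>
    convert Submodule.zero_mem _
    ext; simp [diff]
  | add a b _ _ ha hb =>
    convert Submodule.add_mem _ ha hb using 1
    ext; simp [diff]; ring
  | smul c a _ ha =>
    convert Submodule.smul_mem _ c ha using 1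
    ext; simp [diff]; ring

theorem shift_mem_digitSpan (l : (Fin m → ZMod p) → ZMod p) (hl : l ∈ digitSpan p m)
    (h : Fin m → ZMod p) : (fun x => l (x + h)) ∈ digitSpan p m := by
  have e : (fun x => l (x + h)) = diff h l + l := by ext; simp [diff]
  rw [e]
  refine add_mem ?_ hl
  have : (1 : Submodule (ZMod p) ((Fin m → ZMod p) → ZMod p)) ≤ digitSpan p m := by
    rw [Submodule.one_le]; exact one_mem_digitSpan
  exact this (diff_mem_one_of_mem_digitSpan l hl h)

theorem mod_pow_eq_sum (x b k : ℕ) : x % b ^ k = ∑ e ∈ Finset.range k, b ^ e * (x / b ^ e % b) := by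
  induction k with
  | zero => simp [Nat.mod_one]
  | succ k ih => rw [Nat.mod_pow_succ, ih, Finset.sum_range_succ]

/-- Evaluation at the origin reads off the coefficient with index `0`. This is why witnesses are
required to be nonzero there: the polynomial is then certainly nonzero, despite the repetitions
among the monomials. -/
theorem monomial_digitFun_zero {D t : ℕ} (ht : t < (m + 1) ^ D) :
    monomial (digitFun p m) (m + 1) D t 0 = if t = 0 then 1 else 0 := by
  split_ifs with h
  · simp [h, monomial, digitFun]
  · rw [monomial, Finset.prod_apply]
    by_contra hc
    replace hc := Finset.prod_ne_zero_iff.1 hc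
    apply h
    rw [← Nat.mod_eq_of_lt ht, mod_pow_eq_sum]
    refine Finset.sum_eq_zero fun l hl => ?_
    have := hc l hl
    rcases h0 : t / (m + 1) ^ l % (m + 1) with _ | s
    · simp
    · rw [h0] at this
      simp [digitFun] at this

end DigitFunctions

/-! ### Characters as points of `F_p ^ (n * k)` -/

section Characters

variable {p k n : ℕ} [Fact p.Prime] {ζ : ℂ} (hζ : IsPrimitiveRoot ζ (p ^ k))
  (b : Module.Basis (Fin n) (ZMod (p ^ k)) (Grp p k n))

include hζ

theorem charCoord_spec (χ : Chars p k n) (i : Fin n) :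
    charCoord ζ b χ i < p ^ k ∧ χ (b i) = ζ ^ charCoord ζ b χ i := by
  have hp : 0 < p := (Fact.out : p.Prime).pos
  have h1 : χ (b i) ^ (p ^ k) = 1 := by
    rw [← AddChar.map_nsmul_eq_pow]
    have : p ^ k • b i = 0 := by
      ext j; simp
    rw [this, AddChar.map_zero_eq_one]
  have : NeZero (p ^ k) := ⟨(pow_pos hp k).ne'⟩
  obtain ⟨x, hx, hx'⟩ := hζ.eq_pow_of_pow_eq_one h1
  have hm : x ∈ {x : ℕ | χ (b i) = ζ ^ x} := hx'.symm
  exact ⟨(Nat.sInf_le hm).trans_lt hx, Nat.sInf_mem ⟨x, hm⟩⟩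

theorem char_apply (χ : Chars p k n) (u : Grp p k n) :
    χ u = ζ ^ ∑ i, (b.repr u i).val * charCoord ζ b χ i := by
  have hs : ∀ (I : Finset (Fin n)) (z : Fin n → Grp p k n), χ (∑ i ∈ I, z i) = ∏ i ∈ I, χ (z i) := by
    intro I z
    induction I using Finset.induction_on with
    | empty => simp
    | insert i I hi ih => rw [Finset.sum_insert hi, Finset.prod_insert hi, AddChar.map_add_eq_mul, ih]
  have : NeZero (p ^ k) := ⟨(pow_pos (Fact.out : p.Prime).pos k).ne'⟩
  conv_lhs => rw [← b.sum_repr u]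
  rw [hs, ← Finset.prod_pow_eq_pow_sum]
  refine Finset.prod_congr rfl fun i _ => ?_
  have : b.repr u i • b i = (b.repr u i).val • b i := by
    rw [← Nat.cast_smul_eq_nsmul (ZMod (p ^ k)), ZMod.natCast_zmod_val]
  rw [this, AddChar.map_nsmul_eq_pow, (charCoord_spec hζ b χ i).2, ← pow_mul, mul_comm]

omit hζ

/-- The digits in base `p` of the coordinates of a character. -/
noncomputable def charDigits (ζ : ℂ) (b : Module.Basis (Fin n) (ZMod (p ^ k)) (Grp p k n))
    (χ : Chars p k n) (s : Fin (n * k)) : ZMod p :=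
  ((charCoord ζ b χ s.divNat / p ^ (s.modNat : ℕ) % p : ℕ) : ZMod p)

theorem charDigits_val (χ : Chars p k n) (i : Fin n) (e : Fin k) :
    (charDigits ζ b χ (finProdFinEquiv (i, e))).val = charCoord ζ b χ i / p ^ (e : ℕ) % p := by
  have h := finProdFinEquiv.symm_apply_apply (i, e)
  rw [finProdFinEquiv_symm_apply, Prod.mk.injEq] at h
  rw [charDigits, h.1, h.2, ZMod.val_natCast, Nat.mod_mod]

include hζ

theorem charCoord_eq_sum (χ : Chars p k n) (i : Fin n) :
    charCoord ζ b χ i = ∑ e : Fin k, p ^ (e : ℕ) * (charDigits ζ b χ (finProdFinEquiv (i, e))).val := by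
  simp only [charDigits_val]
  rw [Fin.sum_univ_eq_sum_range (fun e => p ^ e * (charCoord ζ b χ i / p ^ e % p)) k,
    ← mod_pow_eq_sum, Nat.mod_eq_of_lt (charCoord_spec hζ b χ i).1]

/-- The digits determine the coordinates and hence the character, and both sides have `p ^ (k * n)`
elements. -/
theorem charDigits_bijective : Function.Bijective (charDigits ζ b) := by
  refine Function.Injective.bijective_of_nat_card_le (fun χ χ' h => ?_) ?_
  · ext u
    rw [char_apply hζ b, char_apply hζ b]
    simp only [charCoord_eq_sum hζ b, h]
  · have : NeZero (p ^ k) := ⟨(pow_pos (Fact.out : p.Prime).pos k).ne'⟩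
    rw [Nat.card_eq_fintype_card, Nat.card_eq_fintype_card, AddChar.card_eq]
    simp [pow_mul, mul_comm n k]

/-- `χ u` is `ζ` to the power of a sum of digits with weights `u_i * p ^ e`. The function `g` is the
binomial coefficient of this sum plus `p ^ k - 1` over `p ^ k - 1`. -/
theorem charDigits_indicator (u : Grp p k n) :
    ∃ g ∈ digitSpan p (n * k) ^ (p ^ k - 1), g 0 = 1 ∧
      ∀ χ : Chars p k n, χ u ≠ 1 → g (charDigits ζ b χ) = 0 := by
  refine ⟨_, choose_sum_mem_pow one_mem_digitSpan Finset.univ (fun s d => d s)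
    proj_mem_digitSpan (fun s => (b.repr u s.divNat).val * p ^ (s.modNat : ℕ)) (p ^ k - 1), ?_, ?_⟩
  · simp
  · intro χ hχ
    refine choose_eq_zero_of_not_dvd fun hd => hχ ?_
    rw [char_apply hζ b, hζ.pow_eq_one_iff_dvd]
    convert hd using 1
    rw [← finProdFinEquiv.sum_comp, Fintype.sum_prod_type]
    refine Finset.sum_congr rfl fun i _ => ?_
    rw [charCoord_eq_sum hζ b, Finset.mul_sum]
    refine Finset.sum_congr rfl fun e _ => ?_
    have h := finProdFinEquiv.symm_apply_apply (i, e)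
    rw [finProdFinEquiv_symm_apply, Prod.mk.injEq] at h
    rw [h.1, h.2, mul_assoc]

end Characters

/-! ### Refutable systems of linear equations -/

/-- Some linear form vanishing on the first `R` vectors `v j` does not vanish on the first basis
vector. -/
def HasWitness (p N R : ℕ) (v : ℕ → ℕ → ZMod p) : Prop :=
  ∃ w : Fin N → ZMod p, (∀ j < R, ∑ t, w t * v j t = 0) ∧ ∃ t : Fin N, (t : ℕ) = 0 ∧ w t ≠ 0

/-- The values at the digits of `χ` of the monomials of degree at most `p ^ k - 1`. -/
noncomputable def charVec {p k n : ℕ} [Fact p.Prime] (ζ : ℂ)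
    (b : Module.Basis (Fin n) (ZMod (p ^ k)) (Grp p k n)) (χ : Chars p k n) (t : ℕ) : ZMod p :=
  ∏ l ∈ Finset.range (p ^ k - 1),
    digitFun p (n * k) (t / (n * k + 1) ^ l % (n * k + 1)) (charDigits ζ b χ)

section Witness

variable {p k n : ℕ} [Fact p.Prime] {ζ : ℂ} (hζ : IsPrimitiveRoot ζ (p ^ k))
  (b : Module.Basis (Fin n) (ZMod (p ^ k)) (Grp p k n))

theorem charVec_eq (χ : Chars p k n) (t : ℕ) : charVec ζ b χ t =
    monomial (digitFun p (n * k)) (n * k + 1) (p ^ k - 1) t (charDigits ζ b χ) := by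
  simp [charVec, monomial]

include hζ

/-- Completeness for case (i): the coefficients of the polynomial from `charDigits_indicator` form a
witness, whose entry at index `0` is the value `1` at the origin. -/
theorem hasWitness_of_ne_one (u : Grp p k n) (R : ℕ) (s : ℕ → Chars p k n)
    (hs : ∀ j < R, s j u ≠ 1) :
    HasWitness p ((n * k + 1) ^ (p ^ k - 1)) R fun j => charVec ζ b (s j) := by
  obtain ⟨g, hg, hg0, hgu⟩ := charDigits_indicator hζ b u
  obtain ⟨w, rfl⟩ := exists_eq_sum_monomial _ _ _ g hg
  refine ⟨fun t => w t, fun j hj => ?_, ⟨0, by positivity⟩, rfl, fun h0 => ?_⟩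
  · have := hgu _ (hs j hj)
    rw [Finset.sum_range] at this
    simpa [charVec_eq] using this
  · rw [Finset.sum_range, Finset.sum_apply] at hg0
    simp only [Pi.smul_apply, monomial_digitFun_zero (Fin.is_lt _), smul_eq_mul, mul_ite, mul_one,
      mul_zero] at hg0
    rw [Finset.sum_eq_single ⟨0, by positivity⟩] at hg0
    · simp only [if_true] at hg0
      simp only at h0
      rw [h0] at hg0
      exact zero_ne_one hg0
    · intro t _ ht
      rw [if_neg fun h => ht (Fin.ext h)]
    · simp

/-- Soundness for case (ii): a form with nonzero entry at index `0` is a nonzero polynomial of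
degree at most `p ^ k - 1`, to which the support bound applies. -/
theorem card_chars_le [Fintype (Chars p k n)] [DecidableEq (ZMod p)]
    (w : Fin ((n * k + 1) ^ (p ^ k - 1)) → ZMod p)
    (hw : ∃ t : Fin _, (t : ℕ) = 0 ∧ w t ≠ 0) : Fintype.card (Chars p k n) ≤
      2 ^ (p ^ k - 1) * (Finset.univ.filter fun χ : Chars p k n =>
        ∑ t, w t * charVec ζ b χ t ≠ 0).card := by
  set g : (Fin (n * k) → ZMod p) → ZMod p :=
    ∑ t, w t • monomial (digitFun p (n * k)) (n * k + 1) (p ^ k - 1) t with hg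
  have hgm : g ∈ digitSpan p (n * k) ^ (p ^ k - 1) :=
    Submodule.sum_mem _ fun t _ => Submodule.smul_mem _ _ (monomial_mem _ (Nat.succ_pos _) _ _)
  have hg0 : g ≠ 0 := by
    obtain ⟨t, ht, hwt⟩ := hw
    intro h0
    apply hwt
    have := congrFun h0 0
    rw [hg, Finset.sum_apply] at this
    simp only [Pi.smul_apply, monomial_digitFun_zero (Fin.is_lt _), smul_eq_mul, mul_ite, mul_one,
      mul_zero] at this
    rw [Finset.sum_eq_single t] at this
    · simpa [ht] using this
    · intro t' _ ht'
      rw [if_neg fun h => ht' (Fin.ext (h.trans ht.symm))]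
    · simp
  have h := card_le_two_pow_mul_card_support shift_mem_digitSpan diff_mem_one_of_mem_digitSpan _ g
    hgm hg0
  rw [Fintype.card_of_bijective (charDigits_bijective hζ b)]
  refine h.trans (Nat.mul_le_mul_left _ (le_of_eq ?_))
  symm
  refine Finset.card_bijective _ (charDigits_bijective hζ b) fun χ => ?_
  simp [hg, charVec_eq]

end Witness

open MeasureTheory

/-! ### Probability -/

section Probability

variable {p k n : ℕ}

instance (μ : PMF (Chars p k n)) : IsProbabilityMeasure (sampleLaw μ) := by
  unfold sampleLaw; infer_instance

theorem sampleLaw_forall_mem (μ : PMF (Chars p k n)) (R : ℕ) (Z : Set (Chars p k n)) :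
    sampleLaw μ {s | ∀ j < R, s j ∈ Z} = μ.toMeasure Z ^ R := by
  have h := Measure.infinitePi_pi (fun _ : ℕ => μ.toMeasure) (s := Finset.range R)
    (t := fun _ => Z) fun _ _ => MeasurableSpace.measurableSet_top
  rw [Finset.prod_const, Finset.card_range] at h
  rw [← h, sampleLaw]
  congr 1
  ext s
  simp

theorem sampleLaw_eq_one_of_forall {μ : PMF (Chars p k n)} {R : ℕ} {Z : Set (Chars p k n)}
    (hZ : ∀ χ ∉ Z, μ χ = 0) {E : Set (ℕ → Chars p k n)} (hE : ∀ s, (∀ j < R, s j ∈ Z) → s ∈ E) :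
    sampleLaw μ E = 1 := by
  refine le_antisymm prob_le_one ?_
  have h : μ.toMeasure Z = 1 := by
    rw [PMF.toMeasure_apply_eq_one_iff _ MeasurableSpace.measurableSet_top]
    intro χ hχ
    by_contra h
    exact hχ (hZ χ h)
  rw [← one_pow R, ← h, ← sampleLaw_forall_mem]
  exact measure_mono hE

variable [Fact p.Prime]

/-- The complement of `Z` has at least a fraction `1 / q` of all characters, each of mass at least
`1 / c` times the uniform one. -/
theorem toMeasure_real_le {c : ℝ} (hc : 1 ≤ c) {μ : PMF (Chars p k n)}
    (hμ : NearlyUniformOn c μ Set.univ) {Z : Set (Chars p k n)} [Fintype (Chars p k n)]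
    [DecidablePred (· ∈ Z)] {q : ℕ}
    (hZ : Fintype.card (Chars p k n) ≤ q * (Finset.univ.filter fun χ => χ ∉ Z).card) :
    μ.toMeasure.real Z ≤ 1 - 1 / (c * q) := by
  have hcard : 0 < Fintype.card (Chars p k n) := Fintype.card_pos
  have hq : 0 < q := by
    rcases Nat.eq_zero_or_pos q with rfl | h
    · simp at hZ
    · exact h
  have h1 : μ.toMeasure.real Zᶜ = ∑ χ ∈ Finset.univ.filter (fun χ => χ ∉ Z), (μ χ).toReal := by
    have e : Zᶜ = ((Finset.univ.filter fun χ => χ ∉ Z : Finset (Chars p k n)) : Set (Chars p k n)) := by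
      ext; simp
    have : MeasurableSingletonClass (Chars p k n) := ⟨fun _ => MeasurableSpace.measurableSet_top⟩
    rw [Measure.real, e, PMF.toMeasure_apply_finset, ENNReal.toReal_sum]
    exact fun χ _ => μ.apply_ne_top χ
  have h2 : 1 / (c * q) ≤ μ.toMeasure.real Zᶜ := by
    rw [h1]
    have h3 : ∀ χ ∈ Finset.univ.filter (fun χ => χ ∉ Z),
        1 / (c * Fintype.card (Chars p k n)) ≤ (μ χ).toReal := by
      intro χ _
      have := (hμ.2 χ (Set.mem_univ χ)).1
      rwa [Set.ncard_univ, Nat.card_eq_fintype_card] at this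
    have h4 := Finset.card_nsmul_le_sum _ _ _ h3
    refine le_trans ?_ h4
    have h5 : (Fintype.card (Chars p k n) : ℝ) ≤
        q * (Finset.univ.filter fun χ => χ ∉ Z).card := by exact_mod_cast hZ
    rw [nsmul_eq_mul, mul_one_div, div_le_div_iff₀ (by positivity) (by positivity)]
    nlinarith
  have h6 := measureReal_compl (μ := μ.toMeasure) (s := Z) MeasurableSpace.measurableSet_top
  rw [probReal_univ] at h6
  linarith

/-- Union bound over at most `p ^ N ≤ exp (N * p)` forms, each surviving `R` samples with
probability at most `(1 - ε) ^ R ≤ exp (-(N * p + 2))`. The summand `2` in `R` leaves the error `exp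
(-2) ≤ 1/3`. -/
theorem two_thirds_le_sampleLaw {ζ : ℂ} (hζ : IsPrimitiveRoot ζ (p ^ k))
    (b : Module.Basis (Fin n) (ZMod (p ^ k)) (Grp p k n)) {c : ℝ} (hc : 1 ≤ c)
    {μ : PMF (Chars p k n)} (hμ : NearlyUniformOn c μ Set.univ) {N R : ℕ}
    (hN : N = (n * k + 1) ^ (p ^ k - 1)) (hR : R = ⌈c⌉₊ * (2 ^ (p ^ k - 1) * (N * p + 2)))
    {E : Set (ℕ → Chars p k n)}
    (hE : ∀ s, ¬ HasWitness p N R (fun j => charVec ζ b (s j)) → s ∈ E) :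
    2 / 3 ≤ sampleLaw μ E := by
  classical
  have : Fintype (Chars p k n) := Fintype.ofFinite _
  set q := 2 ^ (p ^ k - 1) with hq
  have hq0 : (0 : ℝ) < q := by rw [hq]; positivity
  set ε : ℝ := 1 / (c * q) with hε
  let Z (w : Fin N → ZMod p) : Set (Chars p k n) := {χ | ∑ t, w t * charVec ζ b χ t = 0}
  let W := {w : Fin N → ZMod p // ∃ t : Fin N, (t : ℕ) = 0 ∧ w t ≠ 0}
  have hZ : ∀ w : W, μ.toMeasure.real (Z w.1) ≤ 1 - ε := by
    rintro ⟨w, hw⟩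
    subst hN
    exact toMeasure_real_le hc hμ (card_chars_le hζ b w hw)
  have hcov : Eᶜ ⊆ ⋃ w : W, {s | ∀ j < R, s j ∈ Z w.1} := by
    intro s hs
    have : HasWitness p N R (fun j => charVec ζ b (s j)) := by
      by_contra h; exact hs (hE s h)
    obtain ⟨w, hw, hw0⟩ := this
    exact Set.mem_iUnion.2 ⟨⟨w, hw0⟩, hw⟩
  have hb : (sampleLaw μ).real Eᶜ ≤ 1 / 3 := by
    have h1 : (sampleLaw μ).real Eᶜ ≤ ∑ w : W, (1 - ε) ^ R := by
      refine (measureReal_mono hcov).trans ((measureReal_iUnion_fintype_le _).trans ?_)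
      refine Finset.sum_le_sum fun w _ => ?_
      rw [Measure.real, sampleLaw_forall_mem, ENNReal.toReal_pow]
      exact pow_le_pow_left₀ ENNReal.toReal_nonneg (hZ w) R
    have hε1 : 0 ≤ 1 - ε := by
      have : (1 : ℝ) ≤ q := by exact_mod_cast Nat.one_le_two_pow
      rw [hε, sub_nonneg, div_le_one (by positivity)]
      nlinarith
    have h2 : (1 - ε) ^ R ≤ Real.exp (-(N * p + 2)) := by
      have h3 : 1 - ε ≤ Real.exp (-ε) := by
        have := Real.add_one_le_exp (-ε); linarith
      refine (pow_le_pow_left₀ hε1 h3 R).trans ?_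
      rw [← Real.exp_nat_mul, Real.exp_le_exp]
      have h4 : (N * p + 2 : ℝ) ≤ R * ε := by
        rw [hε, mul_one_div, le_div_iff₀ (by positivity), hR]
        push_cast
        have := Nat.le_ceil c
        have h5 : (0 : ℝ) ≤ q * (N * p + 2) := by positivity
        nlinarith
      linarith
    have h6 : (Fintype.card W : ℝ) ≤ Real.exp (N * p) := by
      have h7 : Fintype.card W ≤ p ^ N := by
        refine (Fintype.card_subtype_le _).trans ?_
        simp [ZMod.card]
      have h8 : (p : ℝ) ≤ Real.exp p := by
        have := Real.add_one_le_exp (p : ℝ); linarith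
      calc (Fintype.card W : ℝ) ≤ (p : ℝ) ^ N := by exact_mod_cast h7
        _ ≤ Real.exp p ^ N := pow_le_pow_left₀ (by positivity) h8 N
        _ = _ := by rw [← Real.exp_nat_mul]
    rw [Finset.sum_const, nsmul_eq_mul, Finset.card_univ] at h1
    have h9 : (3 : ℝ) ≤ Real.exp 2 := by
      have := Real.add_one_le_exp (2 : ℝ); linarith
    calc _ ≤ _ := h1
      _ ≤ Real.exp (N * p) * Real.exp (-(N * p + 2)) := by
        refine mul_le_mul h6 h2 (pow_nonneg hε1 R) (Real.exp_pos _).le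
      _ = (Real.exp 2)⁻¹ := by rw [← Real.exp_add, ← Real.exp_neg]; congr 1; ring
      _ ≤ 1 / 3 := by rw [one_div]; exact inv_anti₀ (by norm_num) h9
  -- Subadditivity suffices here, so measurability of `E` is not needed.
  have hu : (1 : ℝ) ≤ (sampleLaw μ).real E + (sampleLaw μ).real Eᶜ := by
    rw [← probReal_univ (μ := sampleLaw μ), ← Set.union_compl_self E]
    exact measureReal_union_le _ _
  have hf : (2 / 3 : ℝ) ≤ (sampleLaw μ).real E := by linarith
  have := (ENNReal.ofReal_le_iff_le_toReal (measure_ne_top _ _)).2 hf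
  rw [ENNReal.ofReal_div_of_pos (by norm_num)] at this
  simpa using this

end Probability

/-! ### A program logic with registers and a matrix -/

/-- Registers, a matrix, and the number of inputs read. -/
structure Abs where
  σ : ℕ → ℕ
  A : ℕ → ℕ → ℕ
  pos : ℕ

/-- Assign `v` to register `r`. -/
def Abs.set (h : Abs) (r v : ℕ) : Abs := { h with σ := Function.update h.σ r v }

/-- Assign `v` to the matrix entry in row `i` and column `t`. -/
def Abs.setA (h : Abs) (i t v : ℕ) : Abs :=
  { h with A := Function.update h.A i (Function.update (h.A i) t v) }

/-- The state `s` represents `h`: the registers below `28` are kept in place, the registers from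
`28` to `31` are scratch, and the matrix is stored by rows of length `N` from address `32` on. -/
structure Rep (N : ℕ) (h : Abs) (s : State) : Prop where
  reg : ∀ r < 28, s.mem r = h.σ r
  mat : ∀ i t, t < N → s.mem (32 + (i * N + t)) = h.A i t
  pos : s.pos = h.pos

theorem Rep.set {N : ℕ} {h : Abs} {s : State} (H : Rep N h s) {r : ℕ} (hr : r < 28) (v : ℕ) :
    Rep N (h.set r v) (s.set r v) where
  reg r' hr' := by
    by_cases e : r' = r <;> simp [State.set, Abs.set, e, H.reg r' hr']
  mat i t ht := by
    simp only [State.set, Abs.set]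
    rw [Function.update_of_ne (by omega), H.mat i t ht]
  pos := H.pos

theorem Rep.scratch {N : ℕ} {h : Abs} {s : State} (H : Rep N h s) {r : ℕ} (hr : 28 ≤ r)
    (hr' : r < 32) (v : ℕ) : Rep N h (s.set r v) where
  reg r'' hr'' := by
    simp only [State.set]
    rw [Function.update_of_ne (by omega), H.reg r'' hr'']
  mat i t ht := by
    simp only [State.set]
    rw [Function.update_of_ne (by omega), H.mat i t ht]
  pos := H.pos

theorem mul_add_inj_of_lt {N i t i' t' : ℕ} (ht : t < N) (ht' : t' < N)
    (e : i * N + t = i' * N + t') : i = i' ∧ t = t' := by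
  have h1 := congrArg (· / N) e
  have h2 := congrArg (· % N) e
  simp only [Nat.mul_add_mod_of_lt ht, Nat.mul_add_mod_of_lt ht'] at h2
  rw [h2] at e
  exact ⟨Nat.eq_of_mul_eq_mul_right (by omega) (Nat.add_right_cancel e), h2⟩

theorem Rep.setA {N : ℕ} {h : Abs} {s : State} (H : Rep N h s) {i t : ℕ} (ht : t < N) (v : ℕ) :
    Rep N (h.setA i t v) (s.set (32 + (i * N + t)) v) where
  reg r hr := by
    simp only [State.set]
    rw [Function.update_of_ne (by omega), H.reg r hr]; rfl
  mat i' t' ht' := by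
    simp only [State.set, Abs.setA]
    by_cases e : i' = i
    · subst e
      by_cases e' : t' = t
      · subst e'; simp
      · rw [Function.update_of_ne (by omega), H.mat i' t' ht']
        simp [e']
    · rw [Function.update_of_ne, H.mat i' t' ht', Function.update_of_ne e]
      intro h'
      exact e (mul_add_inj_of_lt ht' ht (Nat.add_left_cancel h')).1
  pos := H.pos

/-- From every representation of `h` the program `P` leads in at most `C * u` steps to a
representation of a state with property `Q`. -/
def WP (input : ℕ → ℕ) (N C u : ℕ) (P : Prog) (Q : Abs → Prop) (h : Abs) : Prop :=
  ∀ s, Rep N h s → ∃ s' t h', Exec input P s s' t ∧ t ≤ C * u ∧ Rep N h' s' ∧ Q h'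

section WP

variable {input : ℕ → ℕ} {N C u u' : ℕ} {P P' : Prog} {Q Q' : Abs → Prop} {h : Abs}

theorem WP.mono (H : WP input N C u P Q h) (hu : u ≤ u') (hQ : ∀ h', Q h' → Q' h') :
    WP input N C u' P Q' h := by
  intro s hs
  obtain ⟨s', t, h', he, ht, hr, hq⟩ := H s hs
  exact ⟨s', t, h', he, ht.trans (Nat.mul_le_mul_left _ hu), hr, hQ _ hq⟩

theorem WP.seq (H : WP input N C u P (WP input N C u' P' Q) h) :
    WP input N C (u + u') (P.seq P') Q h := by
  intro s hs
  obtain ⟨s', t, h', he, ht, hr, hq⟩ := H s hs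
  obtain ⟨s'', t', h'', he', ht', hr', hq'⟩ := hq s' hr
  exact ⟨s'', t + t', h'', he.seq he', by rw [mul_add]; omega, hr', hq'⟩

/-- Instructions with access to the matrix. -/
inductive Ins where
  | const (r v : ℕ) : Ins
  | copy (r a : ℕ) : Ins
  | op (o : Op) (r a b : ℕ) : Ins
  /-- register `d` becomes the entry in row `r` and column `c` -/
  | ld (d r c : ℕ) : Ins
  /-- the entry in row `r` and column `c` becomes the content of register `a` -/
  | st (r c a : ℕ) : Ins
  | rd (r : ℕ) : Ins
  /-- if register `c` is nonzero, copy register `a` to register `r` -/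
  | cmov (c r a : ℕ) : Ins

/-- Compute in register `28` the address of the entry in row `r` and column `c`; the number of
columns is in register `7`. -/
def address (r c : ℕ) : Prog :=
  .seq (.op .mul 28 r 7) (.seq (.op .add 28 28 c) (.seq (.const 29 32) (.op .add 28 29 28)))

/-- The program of an instruction. -/
def Ins.prog : Ins → Prog
  | .const r v => .const r v
  | .copy r a => .copy r a
  | .op o r a b => .op o r a b
  | .ld d r c => .seq (address r c) (.load d 28)
  | .st r c a => .seq (address r c) (.store 28 a)
  | .rd r => .read r
  | .cmov c r a => .ite c (.copy r a) .skip

/-- The weakest precondition of an instruction. -/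
def Ins.pre (input : ℕ → ℕ) (N C : ℕ) (Q : Abs → Prop) (h : Abs) : Ins → Prop
  | .const r v => r < 28 ∧ Q (h.set r v)
  | .copy r a => r < 28 ∧ a < 28 ∧ Q (h.set r (h.σ a))
  | .op o r a b => r < 28 ∧ a < 28 ∧ b < 28 ∧ o.cost (h.σ a) (h.σ b) ≤ C ∧
      Q (h.set r (o.value (h.σ a) (h.σ b)))
  | .ld d r c => d < 28 ∧ r < 28 ∧ c < 28 ∧ h.σ 7 = N ∧ h.σ c < N ∧ h.σ r ≤ N + 2 ∧
      Q (h.set d (h.A (h.σ r) (h.σ c)))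
  | .st r c a => r < 28 ∧ c < 28 ∧ a < 28 ∧ h.σ 7 = N ∧ h.σ c < N ∧ h.σ r ≤ N + 2 ∧
      Q (h.setA (h.σ r) (h.σ c) (h.σ a))
  | .rd r => r < 28 ∧ Q ⟨Function.update h.σ r (input h.pos), h.A, h.pos + 1⟩
  | .cmov c r a => c < 28 ∧ r < 28 ∧ a < 28 ∧ Q (h.set r (if h.σ c = 0 then h.σ r else h.σ a))

theorem Op.cost_le (o : Op) (x y : ℕ) : o.cost x y ≤ 1 + o.value x y := by
  unfold Op.cost; omega

theorem Op.cost_add_le (x y : ℕ) : Op.add.cost x y ≤ 1 + y := by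
  simp only [Op.cost, Op.value]; omega

theorem Op.cost_sub (x y : ℕ) : Op.sub.cost x y = 1 := by
  simp only [Op.cost, Op.value]; omega

theorem Op.cost_mod (x y : ℕ) : Op.mod.cost x y = 1 := by
  have := Nat.mod_le x y
  simp only [Op.cost, Op.value]; omega

theorem Op.cost_div (x y : ℕ) : Op.div.cost x y = 1 := by
  have := Nat.div_le_self x y
  simp only [Op.cost, Op.value]; omega

theorem address_spec (hC : (N + 3) * N + 40 ≤ C) {r c : ℕ} (hr : r < 28) (hc : c < 28)
    (h7 : h.σ 7 = N) (hcN : h.σ c < N) (hrN : h.σ r ≤ N + 2) {s : State} (hs : Rep N h s) :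
    ∃ s' t, Exec input (address r c) s s' t ∧ t ≤ C * 4 ∧ Rep N h s' ∧
      s'.mem 28 = 32 + (h.σ r * N + h.σ c) := by
  have hrn : h.σ r * N ≤ (N + 2) * N := Nat.mul_le_mul_right _ hrN
  have e3 : (N + 3) * N = (N + 2) * N + N := by ring
  set s1 := s.set 28 (h.σ r * N) with hs1
  set s2 := s1.set 28 (h.σ r * N + h.σ c) with hs2
  set s3 := s2.set 29 32 with hs3
  set s4 := s3.set 28 (32 + (h.σ r * N + h.σ c)) with hs4
  have r1 : Rep N h s1 := hs.scratch (by norm_num) (by norm_num) _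
  have r2 : Rep N h s2 := r1.scratch (by norm_num) (by norm_num) _
  have r3 : Rep N h s3 := r2.scratch (by norm_num) (by norm_num) _
  have r4 : Rep N h s4 := r3.scratch (by norm_num) (by norm_num) _
  have v1 : s1.mem 28 = h.σ r * N := by simp [hs1, State.set]
  have v2 : s3.mem 28 = h.σ r * N + h.σ c := by simp [hs3, hs2, State.set]
  have v3 : s3.mem 29 = 32 := by simp [hs3, State.set]
  have x1 : Exec input (.op .mul 28 r 7) s s1 (Op.mul.cost (s.mem r) (s.mem 7)) := by
    have := Exec.op (input := input) .mul 28 r 7 s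
    rwa [show Op.mul.value (s.mem r) (s.mem 7) = h.σ r * N by
      simp [Op.value, hs.reg r hr, hs.reg 7 (by norm_num), h7]] at this
  have x2 : Exec input (.op .add 28 28 c) s1 s2 (Op.add.cost (s1.mem 28) (s1.mem c)) := by
    have := Exec.op (input := input) .add 28 28 c s1
    rwa [show Op.add.value (s1.mem 28) (s1.mem c) = h.σ r * N + h.σ c by
      simp [Op.value, r1.reg c hc, v1]] at this
  have x4 : Exec input (.op .add 28 29 28) s3 s4 (Op.add.cost (s3.mem 29) (s3.mem 28)) := by
    have := Exec.op (input := input) .add 28 29 28 s3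
    rwa [show Op.add.value (s3.mem 29) (s3.mem 28) = 32 + (h.σ r * N + h.σ c) by
      simp [Op.value, v2, v3]] at this
  refine ⟨s4, _, x1.seq (x2.seq ((Exec.const 29 32 s2).seq x4)), ?_, r4, by simp [hs4, State.set]⟩
  have c1 := Op.cost_le .mul (s.mem r) (s.mem 7)
  have c2 := Op.cost_le .add (s1.mem 28) (s1.mem c)
  have c4 := Op.cost_le .add (s3.mem 29) (s3.mem 28)
  simp only [Op.value, v1, v2, v3, hs.reg r hr, hs.reg 7 (by norm_num), h7, r1.reg c hc] at c1 c2 c4 ⊢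
  omega

/-- Time is counted in units of price `C`. The worst case is a matrix access: four instructions for
the address and one for the access. Addresses stay below `(N + 3) * N + 32`, so each of these costs
at most `C`. -/
theorem Ins.wp (hC : (N + 3) * N + 40 ≤ C) (x : Ins) (H : x.pre input N C Q h) :
    WP input N C 5 x.prog Q h := by
  intro s hs
  cases x with
  | const r v => exact ⟨_, _, _, .const r v s, by omega, hs.set H.1 v, H.2⟩
  | copy r a =>
    refine ⟨_, _, _, .copy r a s, by omega, hs.set H.1 _, ?_⟩
    rw [hs.reg a H.2.1]; exact H.2.2
  | op o r a b =>
    obtain ⟨hr, ha, hb, hc, hq⟩ := H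
    refine ⟨_, _, _, .op o r a b s, ?_, hs.set hr _, ?_⟩
    · rw [hs.reg a ha, hs.reg b hb]; omega
    · rw [hs.reg a ha, hs.reg b hb]; exact hq
  | ld d r c =>
    obtain ⟨hd, hr, hc, h7, hcN, hrN, hq⟩ := H
    obtain ⟨s', t, he, ht, hs', ha⟩ := address_spec (input := input) hC hr hc h7 hcN hrN hs
    refine ⟨_, _, _, he.seq (.load d 28 s'), by omega, hs'.set hd _, ?_⟩
    rw [ha, hs'.mat _ _ hcN]; exact hq
  | st r c a =>
    obtain ⟨hr, hc, ha, h7, hcN, hrN, hq⟩ := H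
    obtain ⟨s', t, he, ht, hs', hx⟩ := address_spec (input := input) hC hr hc h7 hcN hrN hs
    refine ⟨_, _, _, he.seq (.store 28 a s'), by omega, ?_, hq⟩
    rw [hx, hs'.reg a ha]
    exact hs'.setA hcN _
  | rd r =>
    refine ⟨_, _, ⟨Function.update h.σ r (input h.pos), h.A, h.pos + 1⟩, .read r s, by omega, ?_, H.2⟩
    have := hs.set H.1 (input h.pos)
    exact ⟨by rw [hs.pos]; exact this.reg, by rw [hs.pos]; exact this.mat, by simp [hs.pos]⟩
  | cmov c r a =>
    obtain ⟨hc, hr, ha, hq⟩ := H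
    by_cases h0 : h.σ c = 0
    · rw [if_pos h0] at hq
      refine ⟨_, _, _, .ite_false (by rw [hs.reg c hc, h0]) (.skip s), by omega, ?_, hq⟩
      have : h.set r (h.σ r) = h := by simp [Abs.set]
      rwa [this]
    · rw [if_neg h0] at hq
      refine ⟨_, _, _, .ite_true (by rwa [hs.reg c hc]) (.copy r a s), by omega, ?_, hq⟩
      rw [hs.reg a ha]
      exact hs.set hr _

/-- The program of a list of instructions. -/
def block : List Ins → Prog
  | [] => .skip
  | x :: l => .seq x.prog (block l)

/-- The weakest precondition of a list of instructions. -/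
def blockPre (input : ℕ → ℕ) (N C : ℕ) (Q : Abs → Prop) (h : Abs) : List Ins → Prop
  | [] => Q h
  | x :: l => x.pre input N C (fun h' => blockPre input N C Q h' l) h

theorem WP.block (hC : (N + 3) * N + 40 ≤ C) (l : List Ins) (H : blockPre input N C Q h l) :
    WP input N C (5 * l.length + 1) (block l) Q h := by
  induction l generalizing h with
  | nil => exact fun s hs => ⟨s, 1, h, .skip s, by simp; omega, hs, H⟩
  | cons x l ih =>
    refine (WP.seq ((Ins.wp hC x H).mono le_rfl fun h' => ih)).mono ?_ fun _ => id
    rw [List.length_cons]; omega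

/-- Repeat `P` with register `i` running down from the content of register `b`, exclusively, to
zero. -/
def loop (i b : ℕ) (P : Prog) : Prog :=
  .seq (.copy i b) (.while i (.seq (.const 31 1) (.seq (.op .sub i i 31) P)))

/-- The index of the invariant is the number of rounds still to come, so it starts at `m` and ends
at `0`. In each round, the `3` pays for the test, the constant `1` and the decrement. -/
theorem WP.loop {i b m : ℕ} (hC : 1 ≤ C) (hi : i < 28) (hb : b < 28) (hm : h.σ b = m)
    (I : ℕ → Abs → Prop) (h0 : I m (h.set i m))
    (hstep : ∀ j < m, ∀ h', h'.σ i = j + 1 → I (j + 1) h' →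
      WP input N C u P (fun h'' => h''.σ i = j ∧ I j h'') (h'.set i j))
    (hQ : ∀ h', h'.σ i = 0 → I 0 h' → Q h') :
    WP input N C (m * (u + 3) + 2) (loop i b P) Q h := by
  have key : ∀ j ≤ m, ∀ h', h'.σ i = j → I j h' → WP input N C (j * (u + 3) + 1)
      (.while i (.seq (.const 31 1) (.seq (.op .sub i i 31) P))) Q h' := by
    intro j
    induction j with
    | zero =>
      intro _ h' hi0 hI s hs
      exact ⟨s, 1, h', .while_false (by rw [hs.reg i hi, hi0]), by omega, hs, hQ h' hi0 hI⟩
    | succ j ih =>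
      intro hj h' hi0 hI s hs
      have r1 : Rep N h' (s.set 31 1) := hs.scratch (by norm_num) (by norm_num) _
      have x2 := Exec.op (input := input) .sub i i 31 (s.set 31 1)
      have e1 : (s.set 31 1).mem 31 = 1 := by simp [State.set]
      rw [r1.reg i hi, hi0, e1] at x2
      have r2 : Rep N (h'.set i j) ((s.set 31 1).set i j) := r1.set hi j
      obtain ⟨s', t, h'', he, ht, hr, hq⟩ := hstep j hj h' hi0 hI _ r2
      obtain ⟨s'', t', h''', he', ht', hr', hq'⟩ := ih (by omega) h'' hq.1 hq.2 s' hr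
      refine ⟨s'', _, h''', .while_true (by rw [hs.reg i hi, hi0]; omega)
        ((Exec.const 31 1 s).seq (x2.seq he)) he', ?_, hr', hq'⟩
      rw [Op.cost_sub]
      have : C * ((j + 1) * (u + 3) + 1) = C * u + C * (j * (u + 3) + 1) + C * 3 := by ring
      omega
  intro s hs
  obtain ⟨s', t, h', he, ht, hr, hq⟩ := key m le_rfl (h.set i m) (by simp [Abs.set]) h0
    (s.set i m) (hs.set hi m)
  refine ⟨s', 1 + t, h', ?_, ?_, hr, hq⟩
  · refine Exec.seq ?_ he
    have := Exec.copy (input := input) i b s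
    rwa [hs.reg b hb, hm] at this
  · have : C * (m * (u + 3) + 2) = C * (m * (u + 3) + 1) + C := by ring
    omega

end WP

/-! ### Fragments of the program -/

section Simp

variable (h : Abs) (r v i t : ℕ)

@[simp] theorem Abs.set_σ (r' : ℕ) : (h.set r v).σ r' = if r' = r then v else h.σ r' :=
  Function.update_apply _ _ _ _

@[simp] theorem Abs.set_A : (h.set r v).A = h.A := rfl

@[simp] theorem Abs.set_pos : (h.set r v).pos = h.pos := rfl

@[simp] theorem Abs.setA_σ : (h.setA i t v).σ = h.σ := rfl

@[simp] theorem Abs.setA_A (i' t' : ℕ) :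
    (h.setA i t v).A i' t' = if i' = i ∧ t' = t then v else h.A i' t' := by
  simp only [Abs.setA, Function.update_apply]
  by_cases e : i' = i
  · subst e; simp [Function.update_apply]
  · simp [e]

@[simp] theorem Abs.setA_pos : (h.setA i t v).pos = h.pos := rfl

end Simp

/-- The registers below `ℓ` have the same contents. -/
def Agree (ℓ : ℕ) (h h' : Abs) : Prop := ∀ r < ℓ, h'.σ r = h.σ r

theorem Agree.refl (ℓ : ℕ) (h : Abs) : Agree ℓ h h := fun _ _ => rfl

theorem Agree.trans {ℓ : ℕ} {h h' h'' : Abs} (H : Agree ℓ h h') (H' : Agree ℓ h' h'') :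
    Agree ℓ h h'' := fun r hr => (H' r hr).trans (H r hr)

theorem Agree.mono {ℓ ℓ' : ℕ} {h h' : Abs} (H : Agree ℓ h h') (hl : ℓ' ≤ ℓ) : Agree ℓ' h h' :=
  fun r hr => H r (hr.trans_le hl)

theorem Agree.set {ℓ r : ℕ} {h h' : Abs} (H : Agree ℓ h h') (hr : ℓ ≤ r) (v : ℕ) :
    Agree ℓ h (h'.set r v) := fun r' hr' => by
  rw [Abs.set_σ, if_neg (by omega), H r' hr']

theorem Agree.setA {ℓ : ℕ} {h h' : Abs} (H : Agree ℓ h h') (i t v : ℕ) :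
    Agree ℓ h (h'.setA i t v) := H

/-- The registers hold the parameters of the computation. -/
structure Params (p k n D N : ℕ) (h : Abs) : Prop where
  r0 : h.σ 0 = p
  r1 : h.σ 1 = k
  r2 : h.σ 2 = n
  r4 : h.σ 4 = 1
  r5 : h.σ 5 = n * k + 1
  r6 : h.σ 6 = D
  r7 : h.σ 7 = N
  r9 : h.σ 9 = N + 1
  r10 : h.σ 10 = N + 2
  r11 : h.σ 11 = 0

theorem Params.agree {p k n D N : ℕ} {h h' : Abs} (H : Params p k n D N h) {ℓ : ℕ}
    (ha : Agree ℓ h h') (hl : 12 ≤ ℓ) : Params p k n D N h' where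
  r0 := (ha 0 (by omega)).trans H.r0
  r1 := (ha 1 (by omega)).trans H.r1
  r2 := (ha 2 (by omega)).trans H.r2
  r4 := (ha 4 (by omega)).trans H.r4
  r5 := (ha 5 (by omega)).trans H.r5
  r6 := (ha 6 (by omega)).trans H.r6
  r7 := (ha 7 (by omega)).trans H.r7
  r9 := (ha 9 (by omega)).trans H.r9
  r10 := (ha 10 (by omega)).trans H.r10
  r11 := (ha 11 (by omega)).trans H.r11

/-- Read the coordinates of a character, and store a `1` and their digits in row `N + 2`. -/
def readProg : Prog :=
  .seq (block [.st 10 11 4, .copy 14 4])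
    (loop 13 2 (.seq (block [.rd 16])
      (loop 15 1 (block [.op .mod 17 16 0, .st 10 14 17, .op .div 16 16 0, .op .add 14 14 4]))))

/-- Store the values of the monomials in row `N`. -/
def monomialProg : Prog :=
  loop 13 7 (.seq (block [.copy 14 13, .copy 15 4])
    (.seq (loop 16 6 (block [.op .mod 17 14 5, .op .div 14 14 5, .ld 18 10 17, .op .mul 15 15 18,
      .op .mod 15 15 0])) (block [.st 7 13 15])))

/-- Store the products of the first `N` rows with row `N` in row `N + 1`, and put a nonzero product
and its index into the registers `14` and `15`, if there is one. -/
def productProg : Prog :=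
  .seq (block [.copy 14 4, .copy 15 11])
    (loop 13 7 (.seq (block [.copy 16 11])
      (.seq (loop 17 7 (block [.ld 18 13 17, .ld 19 7 17, .op .mul 18 18 19, .op .add 16 16 18,
        .op .mod 16 16 0])) (block [.st 9 13 16, .cmov 16 14 16, .cmov 16 15 13]))))

/-- Eliminate with the row whose index is in register `15`. -/
def eliminateProg : Prog :=
  loop 16 7 (.seq (block [.ld 17 15 16])
    (loop 18 7 (block [.ld 19 18 16, .op .mul 19 19 14, .ld 20 9 18, .op .sub 20 0 20,
      .op .mul 20 20 17, .op .add 19 19 20, .op .mod 19 19 0, .st 18 16 19])))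

/-! ### Correctness and cost of the fragments -/

section Specs

variable {input : ℕ → ℕ} {p k n D N C : ℕ} {h : Abs}

theorem readProg_spec (hC : (N + 3) * N + 40 ≤ C) (hN : n * k < N) (H : Params p k n D N h) :
    WP input N C (11 + (n * (6 + (k * (21 + 3) + 2) + 3) + 2)) readProg (fun h' =>
      Agree 13 h h' ∧ h'.pos = h.pos + n ∧ (∀ i t, i ≠ N + 2 → h'.A i t = h.A i t) ∧
      h'.A (N + 2) 0 = 1 ∧
      ∀ s < n * k, h'.A (N + 2) (s + 1) = input (h.pos + s / k) / p ^ (s % k) % p) h := by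
  refine WP.seq ((WP.block hC _ ?_).mono le_rfl fun _ => id)
  have H' := H
  obtain ⟨h0, h1, h2, h4, h5, h6, h7, h9, h10, h11⟩ := H
  simp only [blockPre, Ins.pre, Abs.setA_σ, h4, h7, h10, h11]
  refine ⟨by norm_num, by norm_num, by norm_num, trivial, by omega, le_rfl, by norm_num, by norm_num, ?_⟩
  set g := (h.setA (N + 2) 0 1).set 14 1 with hg
  refine WP.loop (m := n) (by omega) (by norm_num) (by norm_num) (by simp [hg, h2]) (fun j h' =>
    ∃ i, i + j = n ∧ Agree 13 h h' ∧ h'.pos = h.pos + i ∧ h'.σ 14 = i * k + 1 ∧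
      (∀ i t, i ≠ N + 2 → h'.A i t = h.A i t) ∧ h'.A (N + 2) 0 = 1 ∧
      ∀ s < i * k, h'.A (N + 2) (s + 1) = input (h.pos + s / k) / p ^ (s % k) % p) ?_ ?_ ?_
  · refine ⟨0, by omega, ((Agree.refl _ _).setA _ _ _).set (by norm_num) _ |>.set le_rfl _, rfl,
      by simp [hg], ?_, by simp [hg], by simp⟩
    intro i t hi
    simp [hg, hi]
  · rintro j hj h' hj' ⟨i, hij, hag, hpos, h14, hrow, hY0, hY⟩
    have P := H'.agree hag (by norm_num)
    refine WP.seq ((WP.block hC _ ?_).mono le_rfl fun _ => id)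
    simp only [blockPre, Ins.pre]
    refine ⟨by norm_num, ?_⟩
    refine WP.loop (m := k) (by omega) (by norm_num) (by norm_num) ?_ (fun j' h'' =>
      ∃ e, e + j' = k ∧ Agree 13 h h'' ∧ h''.σ 13 = j ∧ h''.pos = h.pos + (i + 1) ∧
        h''.σ 14 = i * k + e + 1 ∧ h''.σ 16 = input (h.pos + i) / p ^ e ∧
        (∀ i t, i ≠ N + 2 → h''.A i t = h.A i t) ∧ h''.A (N + 2) 0 = 1 ∧
        ∀ s < i * k + e, h''.A (N + 2) (s + 1) = input (h.pos + s / k) / p ^ (s % k) % p) ?_ ?_ ?_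
    · simp [P.r1]
    · refine ⟨0, by omega, ?_, by simp, by simp [hpos, add_assoc],
        by simp [h14], by simp [hpos], hrow, hY0, by simpa using hY⟩
      exact ((hag.set (le_refl 13) j).set (show 13 ≤ 16 by norm_num) _).set (show 13 ≤ 15 by norm_num) k
    · rintro j' hjk g' hg' ⟨e, hek, hag', h13, hpos', h14', h16, hrow', hY0', hY'⟩
      have P' := H'.agree hag' (by norm_num)
      refine (WP.block hC _ ?_).mono le_rfl fun _ => id
      -- Column `0` holds the constant `1`, so digits are shifted by one; they fit in the row
      -- because `n * k < N`.
      have hbound : i * k + e + 1 < N := by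
        have : (i + 1) * k ≤ n * k := Nat.mul_le_mul_right _ (by omega)
        have : (i + 1) * k = i * k + k := by ring
        omega
      have hcost := Op.cost_add_le (i * k + e + 1) 1
      simp [blockPre, Ins.pre, Op.value, Op.cost_mod, Op.cost_div, P'.r0, P'.r4, P'.r7, P'.r10, h14', h16]
      refine ⟨by omega, hbound, by omega, by omega, ?_⟩
      · refine ⟨e + 1, by omega, ?_, by simpa using h13, by simpa using hpos', by omega,
          by simp [pow_succ, Nat.div_div_eq_div_mul], ?_, ?_, ?_⟩
        · exact (((((hag'.set (by norm_num) _).set (by norm_num) _).setA _ _ _).set (by norm_num) _).set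
            (by norm_num) _)
        · intro i' t hi'
          simp [hi', hrow' i' t hi']
        · simp [hY0']
        · intro s hs
          rcases Nat.lt_succ_iff_lt_or_eq.1 (show s < (i * k + e) + 1 by omega) with h | rfl
          · simpa [h.ne] using hY' s h
          · have hk : e < k := by omega
            have e1 : (i * k + e) / k = i := by
              rw [add_comm, Nat.add_mul_div_right _ _ (by omega), Nat.div_eq_of_lt hk, zero_add]
            simp [e1, Nat.mul_add_mod_of_lt hk]
    · rintro g' - ⟨e, hek, hag', h13, hpos', h14', h16, hrow', hY0', hY'⟩
      obtain rfl : e = k := by omega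
      exact ⟨h13, i + 1, by omega, hag', hpos', by rw [h14']; ring, hrow', hY0', by
        rwa [show (i + 1) * e = i * e + e by ring]⟩
  · rintro h' - ⟨i, hi, hag, hpos, h14, hrow, hY0, hY⟩
    obtain rfl : i = n := by omega
    exact ⟨hag, hpos, hrow, hY0, hY⟩

end Specs

section Specs

variable {input : ℕ → ℕ} {p k n D N C : ℕ} {h : Abs}

theorem monomialProg_spec (hC : (N + 3) * N + 40 ≤ C) (hC' : 2 * (p * p) + 40 ≤ C) (hp : 1 < p)
    (hN : n * k < N) (H : Params p k n D N h) (hY : ∀ s ≤ n * k, h.A (N + 2) s < p) :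
    WP input N C (N * ((11 + (D * (26 + 3) + 2 + 6)) + 3) + 2) monomialProg (fun h' =>
      Agree 13 h h' ∧ h'.pos = h.pos ∧ (∀ i t, i ≠ N → h'.A i t = h.A i t) ∧
      ∀ t < N, h'.A N t < p ∧ (h'.A N t : ZMod p) =
        ∏ l ∈ Finset.range D, (h.A (N + 2) (t / (n * k + 1) ^ l % (n * k + 1)) : ZMod p)) h := by
  refine WP.loop (m := N) (by omega) (by norm_num) (by norm_num) H.r7 (fun j h' =>
    Agree 13 h h' ∧ h'.pos = h.pos ∧ (∀ i t, i ≠ N → h'.A i t = h.A i t) ∧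
      ∀ t < N, j ≤ t → h'.A N t < p ∧ (h'.A N t : ZMod p) =
        ∏ l ∈ Finset.range D, (h.A (N + 2) (t / (n * k + 1) ^ l % (n * k + 1)) : ZMod p)) ?_ ?_ ?_
  · exact ⟨(Agree.refl _ _).set le_rfl _, rfl, fun _ _ _ => rfl, fun t ht ht' => by omega⟩
  · rintro j hj h' - ⟨hag, hpos, hrow, hV⟩
    have P := H.agree hag (by norm_num)
    refine WP.seq ((WP.block hC _ ?_).mono le_rfl fun _ => id)
    simp only [blockPre, Ins.pre]
    refine ⟨by norm_num, by norm_num, by norm_num, by norm_num, WP.seq ?_⟩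
    refine WP.loop (m := D) (by omega) (by norm_num) (by norm_num) (by simp [P.r6]) (fun i g =>
      ∃ l, l + i = D ∧ Agree 13 h g ∧ g.pos = h.pos ∧ g.A = h'.A ∧ g.σ 13 = j ∧
        g.σ 14 = j / (n * k + 1) ^ l ∧ g.σ 15 < p ∧ (g.σ 15 : ZMod p) = ∏ l ∈ Finset.range l,
          (h.A (N + 2) (j / (n * k + 1) ^ l % (n * k + 1)) : ZMod p)) ?_ ?_ ?_
    · refine ⟨0, by omega, ?_, hpos, rfl, by simp, by simp, by simp [P.r4, hp], by simp [P.r4]⟩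
      exact (((hag.set le_rfl _).set (by norm_num) _).set (by norm_num) _).set (by norm_num) _
    · rintro i hi g - ⟨l, hl, hag', hpos', hA, h13, h14, h15, hprod⟩
      have P' := H.agree hag' (by norm_num)
      refine (WP.block hC _ ?_).mono le_rfl fun _ => id
      have hM := Nat.mod_lt (j / (n * k + 1) ^ l) (Nat.succ_pos (n * k))
      set c := j / (n * k + 1) ^ l % (n * k + 1) with hc
      have hy := hY c (by omega)
      have hcost := Op.cost_le .mul (g.σ 15) (h.A (N + 2) c)
      have hle : g.σ 15 * h.A (N + 2) c ≤ p * p := Nat.mul_le_mul h15.le hy.le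
      simp [blockPre, Ins.pre, Op.value, Op.cost_mod, Op.cost_div, P'.r0, P'.r5, P'.r7, P'.r10,
        h14, hA, ← hc, hrow (N + 2) c (by omega)]
      simp only [Op.value] at hcost
      refine ⟨by omega, by omega, by omega, by omega, l + 1, by omega, ?_, hpos', h13,
        ?_, ?_, ?_⟩
      · exact (((((hag'.set (by norm_num) _).set (by norm_num) _).set (by norm_num) _).set
          (by norm_num) _).set (by norm_num) _).set (by norm_num) _
      · rw [pow_succ, Nat.div_div_eq_div_mul]
      · exact Nat.mod_lt _ (by omega)
      · rw [Finset.prod_range_succ, ← hprod]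
    · rintro g - ⟨l, hl, hag', hpos', hA, h13, h14, h15, hprod⟩
      have P' := H.agree hag' (by norm_num)
      obtain rfl : l = D := by omega
      refine (WP.block hC _ ?_).mono le_rfl fun _ => id
      simp [blockPre, Ins.pre, P'.r7, h13, hA, hj]
      refine ⟨hag'.setA _ _ _, hpos', ?_, ?_⟩
      · intro i t hi
        simp [hi, hrow i t hi]
      · intro t ht htj
        by_cases e : t = j
        · subst e; simpa [hprod] using h15
        · simpa [e] using hV t ht (by omega)
  · rintro h' - ⟨hag, hpos, hrow, hV⟩
    exact ⟨hag, hpos, hrow, fun t ht => hV t ht (Nat.zero_le t)⟩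

theorem productProg_spec (hC : (N + 3) * N + 40 ≤ C) (hC' : 2 * (p * p) + 40 ≤ C) (hp : 1 < p)
    (hN : 0 < N) (H : Params p k n D N h) (hW : ∀ i ≤ N, ∀ t < N, h.A i t < p) :
    WP input N C (11 + (N * ((6 + (N * (26 + 3) + 2 + 16)) + 3) + 2)) productProg (fun h' =>
      Agree 13 h h' ∧ h'.pos = h.pos ∧ (∀ i t, i ≠ N + 1 → h'.A i t = h.A i t) ∧
      (∀ i < N, h'.A (N + 1) i < p ∧ (h'.A (N + 1) i : ZMod p) =
        ∑ t ∈ Finset.range N, (h.A i t * h.A N t : ZMod p)) ∧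
      h'.σ 15 < N ∧ h'.σ 14 < p ∧ h'.σ 14 ≠ 0 ∧
      (h'.A (N + 1) (h'.σ 15) = h'.σ 14 ∨ ∀ i < N, h'.A (N + 1) i = 0)) h := by
  refine WP.seq ((WP.block hC _ ?_).mono le_rfl fun _ => id)
  simp only [blockPre, Ins.pre]
  refine ⟨by norm_num, by norm_num, by norm_num, by norm_num, ?_⟩
  -- Registers `14` and `15` start as the dummy pivot value `1` at index `0`. Either they have been
  -- replaced by a genuine pivot, or all products computed so far vanish; the value is nonzero in
  -- both cases.
  refine WP.loop (m := N) (by omega) (by norm_num) (by norm_num) (by simp [H.r7]) (fun j h' =>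
    Agree 13 h h' ∧ h'.pos = h.pos ∧ (∀ i t, i ≠ N + 1 → h'.A i t = h.A i t) ∧
      (∀ i < N, j ≤ i → h'.A (N + 1) i < p ∧ (h'.A (N + 1) i : ZMod p) =
        ∑ t ∈ Finset.range N, (h.A i t * h.A N t : ZMod p)) ∧
      h'.σ 15 < N ∧ h'.σ 14 < p ∧ h'.σ 14 ≠ 0 ∧
      ((j ≤ h'.σ 15 ∧ h'.A (N + 1) (h'.σ 15) = h'.σ 14) ∨
        ∀ i < N, j ≤ i → h'.A (N + 1) i = 0)) ?_ ?_ ?_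
  · refine ⟨?_, rfl, fun _ _ _ => rfl, fun t ht ht' => by omega, by simpa [H.r11] using hN,
      by simpa [H.r4] using hp, by simp [H.r4], Or.inr fun t ht ht' => by omega⟩
    exact (((Agree.refl _ _).set (by norm_num) _).set (by norm_num) _).set le_rfl _
  · rintro j hj h' - ⟨hag, hpos, hrow, hA', h15, h14, h14', hpiv⟩
    have P := H.agree hag (by norm_num)
    refine WP.seq ((WP.block hC _ ?_).mono le_rfl fun _ => id)
    simp only [blockPre, Ins.pre]
    refine ⟨by norm_num, by norm_num, WP.seq ?_⟩
    refine WP.loop (m := N) (by omega) (by norm_num) (by norm_num) (by simp [P.r7]) (fun i g =>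
      Agree 13 h g ∧ g.pos = h.pos ∧ g.A = h'.A ∧ g.σ 13 = j ∧ g.σ 14 = h'.σ 14 ∧
        g.σ 15 = h'.σ 15 ∧ g.σ 16 < p ∧ (g.σ 16 : ZMod p) =
          ∑ t ∈ Finset.Ico i N, (h.A j t * h.A N t : ZMod p)) ?_ ?_ ?_
    · refine ⟨?_, hpos, rfl, by simp, by simp, by simp, by simp [P.r11]; omega, by simp [P.r11]⟩
      exact ((hag.set le_rfl _).set (by norm_num) _).set (by norm_num) _
    · rintro i hi g - ⟨hag', hpos', hA, h13, g14, g15, g16, hsum⟩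
      have P' := H.agree hag' (by norm_num)
      refine (WP.block hC _ ?_).mono le_rfl fun _ => id
      have hx := hW j hj.le i hi
      have hy := hW N le_rfl i hi
      have hcost := Op.cost_le .mul (h.A j i) (h.A N i)
      have hcost' := Op.cost_add_le (g.σ 16) (h.A j i * h.A N i)
      have hle : h.A j i * h.A N i ≤ p * p := Nat.mul_le_mul hx.le hy.le
      simp only [Op.value] at hcost
      simp [blockPre, Ins.pre, Op.value, Op.cost_mod, P'.r0, P'.r7, h13, hA,
        hrow j i (by omega), hrow N i (by omega)]
      refine ⟨by omega, by omega, by omega, by omega, by omega, by omega, ?_, hpos', g14, g15,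
        Nat.mod_lt _ (by omega), ?_⟩
      · exact (((((hag'.set (by norm_num) _).set (by norm_num) _).set (by norm_num) _).set
          (by norm_num) _).set (by norm_num) _).set (by norm_num) _
      · rw [Finset.sum_eq_sum_Ico_succ_bot hi, ← hsum, add_comm]
    · rintro g - ⟨hag', hpos', hA, h13, g14, g15, g16, hsum⟩
      have P' := H.agree hag' (by norm_num)
      refine (WP.block hC _ ?_).mono le_rfl fun _ => id
      rw [← Finset.range_eq_Ico] at hsum
      simp [blockPre, Ins.pre, P'.r7, P'.r9, h13, hA, hj, g14, g15]
      refine ⟨?_, hpos', ?_, ?_, ?_, ?_, ?_, ?_⟩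
      · exact ((hag'.setA _ _ _).set (by norm_num) _).set (by norm_num) _
      · intro i t hi
        simp [hi, hrow i t hi]
      · intro i hi hij
        by_cases e : i = j
        · subst e; simpa [hsum] using g16
        · simpa [e] using hA' i hi (by omega)
      · split_ifs <;> assumption
      · split_ifs <;> assumption
      · split_ifs <;> assumption
      · by_cases e : g.σ 16 = 0
        · simp only [e, if_true]
          rcases hpiv with ⟨h1, h2⟩ | h1
          · exact Or.inl ⟨by omega, by simpa [show h'.σ 15 ≠ j by omega] using h2⟩
          · refine Or.inr fun i hi hij => ?_
            by_cases e' : i = j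
            · simp [e']
            · simpa [e'] using h1 i hi (by omega)
        · simp [e]
  · rintro h' - ⟨hag, hpos, hrow, hA', h15, h14, h14', hpiv⟩
    exact ⟨hag, hpos, hrow, fun i hi => hA' i hi (Nat.zero_le i), h15, h14, h14',
      hpiv.imp (fun x => x.2) fun x i hi => x i hi (Nat.zero_le i)⟩

/-- The update works in place, column by column: the pivot entry of a column is saved in register
`17` before the inner loop overwrites it. Using `p - a` for `-a` avoids negative numbers. -/
theorem eliminateProg_spec (hC : (N + 3) * N + 40 ≤ C) (hC' : 2 * (p * p) + 40 ≤ C)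
    (H : Params p k n D N h) (hW : ∀ i < N, ∀ t < N, h.A i t < p) (h15 : h.σ 15 < N)
    (h14 : h.σ 14 < p) :
    WP input N C (N * ((6 + (N * (41 + 3) + 2)) + 3) + 2) eliminateProg (fun h' =>
      Agree 13 h h' ∧ h'.pos = h.pos ∧ ∀ i < N, ∀ t < N, h'.A i t =
        (h.A i t * h.σ 14 + (p - h.A (N + 1) i) * h.A (h.σ 15) t) % p) h := by
  refine WP.loop (m := N) (by omega) (by norm_num) (by norm_num) H.r7 (fun j h' =>
    Agree 16 h h' ∧ h'.pos = h.pos ∧ (∀ t, h'.A (N + 1) t = h.A (N + 1) t) ∧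
      ∀ i < N, ∀ t < N, h'.A i t = if t < j then h.A i t else
        (h.A i t * h.σ 14 + (p - h.A (N + 1) i) * h.A (h.σ 15) t) % p) ?_ ?_ ?_
  · refine ⟨(Agree.refl _ _).set le_rfl _, rfl, fun _ => rfl, fun i hi t ht => ?_⟩
    simp [ht]
  · rintro j hj h' - ⟨hag, hpos, hA, hA'⟩
    have P := H.agree hag (by norm_num)
    have e15 := hag 15 (by norm_num)
    refine WP.seq ((WP.block hC _ ?_).mono le_rfl fun _ => id)
    simp [blockPre, Ins.pre, P.r7, e15, hj]
    refine ⟨by omega, ?_⟩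
    rw [hA' _ h15 j hj, if_pos (Nat.lt_succ_self j)]
    set z := h.A (h.σ 15) j with hz
    have hzp : z < p := hW _ h15 j hj
    refine WP.loop (m := N) (by omega) (by norm_num) (by norm_num) (by simp [P.r7]) (fun i g =>
      Agree 16 h g ∧ g.pos = h.pos ∧ (∀ t, g.A (N + 1) t = h.A (N + 1) t) ∧ g.σ 16 = j ∧
      g.σ 17 = z ∧ ∀ i' < N, ∀ t < N, g.A i' t = if t < j ∨ t = j ∧ i' < i then h.A i' t else
        (h.A i' t * h.σ 14 + (p - h.A (N + 1) i') * h.A (h.σ 15) t) % p) ?_ ?_ ?_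
    · refine ⟨?_, hpos, hA, by simp, by simp, ?_⟩
      · exact ((hag.set le_rfl _).set (by norm_num) _).set (by norm_num) _
      · intro i' hi' t ht
        simp only [Abs.set_A, hA' i' hi' t ht]
        congr 1
        exact propext ⟨fun h => by omega, fun h => by omega⟩
    · rintro i hi g - ⟨hag', hpos', gA, g16, g17, gW⟩
      have P' := H.agree hag' (by norm_num)
      refine (WP.block hC _ ?_).mono le_rfl fun _ => id
      have hx := hW i hi j hj
      have hgx := gW i hi j hj
      rw [if_pos (Or.inr ⟨rfl, Nat.lt_succ_self i⟩)] at hgx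
      have e14 := hag' 14 (by norm_num)
      have c1 := Op.cost_le .mul (h.A i j) (h.σ 14)
      have c2 := Op.cost_le .mul (p - h.A (N + 1) i) z
      have c3 := Op.cost_add_le (h.A i j * h.σ 14) ((p - h.A (N + 1) i) * z)
      have l1 : h.A i j * h.σ 14 ≤ p * p := Nat.mul_le_mul hx.le h14.le
      have l2 : (p - h.A (N + 1) i) * z ≤ p * p := Nat.mul_le_mul (Nat.sub_le _ _) hzp.le
      simp only [Op.value] at c1 c2
      simp [blockPre, Ins.pre, Op.value, Op.cost_mod, Op.cost_sub, P'.r0, P'.r7, P'.r9, g16, g17,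
        e14, gA, hgx]
      refine ⟨hj, by omega, by omega, hi, by omega, by omega, by omega, by omega, hj, by omega,
        ?_, hpos', ?_, ?_⟩
      · refine Agree.setA ?_ _ _ _
        exact (((((((hag'.set (by norm_num) _).set (by norm_num) _).set (by norm_num) _).set
          (by norm_num) _).set (by norm_num) _).set (by norm_num) _).set (by norm_num) _).set
          (by norm_num) _
      · intro e
        omega
      · intro i' hi' t ht
        by_cases e : i' = i ∧ t = j
        · obtain ⟨rfl, rfl⟩ := e
          simp [hz]
        · rw [if_neg e, gW i' hi' t ht]
          congr 1
          exact propext ⟨fun h => by omega, fun h => by omega⟩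
    · rintro g - ⟨hag', hpos', gA, g16, g17, gW⟩
      refine ⟨g16, hag', hpos', gA, fun i hi t ht => ?_⟩
      rw [gW i hi t ht]
      simp
  · rintro h' - ⟨hag, hpos, hA, hA'⟩
    refine ⟨hag.mono (by norm_num), hpos, fun i hi t ht => ?_⟩
    simpa using hA' i hi t ht

end Specs

/-! ### Elimination -/

section Elimination

variable {F : Type*} [Field F] {N : ℕ}

/-- The new rows pair to zero with `v` by the choice of the pivot. Conversely, if `∑ c i • W i`
pairs to zero with `v`, the multiples of `W i₀` cancel in `∑ c i • (α • W i - a i • W i₀)`, leaving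
`α` times the vector. Inverses occur only in this proof, not in the computation. If all `a i`
vanish, any nonzero `α` works. -/
theorem mem_span_eliminate_iff (W : Fin N → Fin N → F) (v a : Fin N → F)
    (ha : ∀ i, a i = ∑ t, W i t * v t) {α : F} (hα : α ≠ 0) (i₀ : Fin N)
    (h : a i₀ = α ∨ ∀ i, a i = 0) (w : Fin N → F) :
    w ∈ Submodule.span F (Set.range fun i => α • W i - a i • W i₀) ↔
      w ∈ Submodule.span F (Set.range W) ∧ ∑ t, w t * v t = 0 := by
  let φ : (Fin N → F) →ₗ[F] F := ∑ t, v t • LinearMap.proj t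
  have hφ : ∀ w, φ w = ∑ t, w t * v t := fun w => by
    simp [φ, mul_comm]
  have hφW : ∀ i, φ (W i) = a i := fun i => by rw [hφ, ha]
  rw [← hφ]
  constructor
  · intro hw
    have hle : Submodule.span F (Set.range fun i => α • W i - a i • W i₀) ≤
        Submodule.span F (Set.range W) ⊓ LinearMap.ker φ := by
      rw [Submodule.span_le]
      rintro _ ⟨i, rfl⟩
      refine ⟨Submodule.sub_mem _ (Submodule.smul_mem _ _ (Submodule.subset_span ⟨i, rfl⟩))
        (Submodule.smul_mem _ _ (Submodule.subset_span ⟨i₀, rfl⟩)), ?_⟩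
      simp only [SetLike.mem_coe, LinearMap.mem_ker, map_sub, map_smul, hφW, smul_eq_mul]
      rcases h with h | h
      · rw [h]; ring
      · rw [h, h]; ring
    exact hle hw
  · rintro ⟨hw, h0⟩
    obtain ⟨c, rfl⟩ := (Submodule.mem_span_range_iff_exists_fun F).1 hw
    rw [map_sum] at h0
    simp only [map_smul, hφW, smul_eq_mul] at h0
    have e : ∑ i, c i • W i = α⁻¹ • ∑ i, c i • (α • W i - a i • W i₀) := by
      simp only [smul_sub, smul_smul (c _), Finset.sum_sub_distrib, ← Finset.sum_smul, h0, zero_smul,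
        sub_zero]
      simp only [mul_comm _ α, ← smul_smul, ← Finset.smul_sum]
      rw [smul_smul, inv_mul_cancel₀ hα, one_smul]
    rw [e]
    exact Submodule.smul_mem _ _ (Submodule.sum_mem _ fun i _ =>
      Submodule.smul_mem _ _ (Submodule.subset_span ⟨i, rfl⟩))

end Elimination

/-! ### The complete algorithm: setup, sampling loop and output -/

/-- The digits of the coordinates of the `j`-th character in the input stream, preceded by `1`. -/
def inputDigit (p k n : ℕ) (input : ℕ → ℕ) (j : ℕ) : ℕ → ℕ
  | 0 => 1
  | s + 1 => input (j * n + s / k) / p ^ (s % k) % p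

/-- The values of the monomials of degree at most `D` at the `j`-th character. -/
def inputVec (p k n D : ℕ) (input : ℕ → ℕ) (j t : ℕ) : ZMod p :=
  ∏ l ∈ Finset.range D, (inputDigit p k n input j (t / (n * k + 1) ^ l % (n * k + 1)) : ZMod p)

/-- The first `N` rows of the matrix, with entries modulo `p`. -/
def rows (p N : ℕ) (h : Abs) (i t : Fin N) : ZMod p := (h.A i t : ZMod p)

/-- Process one character. -/
def sampleProg : Prog := .seq readProg (.seq monomialProg (.seq productProg eliminateProg))

/-- The number of steps of `sampleProg`, up to the cost of an operation. -/
def sampleUnits (k n D N : ℕ) : ℕ :=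
  11 + (n * (6 + (k * (21 + 3) + 2) + 3) + 2) + (N * ((11 + (D * (26 + 3) + 2 + 6)) + 3) + 2 +
    (11 + (N * ((6 + (N * (26 + 3) + 2 + 16)) + 3) + 2) + (N * ((6 + (N * (41 + 3) + 2)) + 3) + 2)))

/-- Replace the first `N` rows of the matrix by the identity matrix. -/
def initProg : Prog := loop 12 7 (block [.st 12 12 4])

/-- Decide whether the first column of the first `N` rows of the matrix vanishes. -/
def outputProg : Prog :=
  .seq (block [.copy 12 4]) (.seq (loop 13 7 (block [.ld 14 13 11, .cmov 14 12 11]))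
    (block [.copy 0 12]))

/-- Compute the parameters from `p`, `k`, `n` and `c`. -/
def setupProg : Prog :=
  .seq (block [.const 4 1, .const 6 1]) (.seq (loop 12 1 (block [.op .mul 6 6 0]))
    (.seq (block [.op .sub 6 6 4, .op .mul 5 2 1, .op .add 5 5 4, .const 7 1])
      (.seq (loop 12 6 (block [.op .mul 7 7 5]))
        (.seq (block [.op .add 9 7 4, .op .add 10 9 4, .op .mul 8 7 0, .const 13 2,
            .op .add 8 8 13])
          (.seq (loop 12 6 (block [.op .mul 8 8 13])) (block [.op .mul 8 8 3]))))))

section Specs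

variable {input : ℕ → ℕ} {p k n D N C : ℕ} {h : Abs}

/-- One sample replaces the row span by its intersection with the forms vanishing on the vector of
that sample. Row `N` holds this vector, row `N + 1` its products with the rows, row `N + 2` the
digits. -/
theorem sampleProg_spec [Fact p.Prime] (hC : (N + 3) * N + 40 ≤ C) (hC' : 2 * (p * p) + 40 ≤ C)
    (hN : n * k < N) (H : Params p k n D N h) {j : ℕ} (hpos : h.pos = j * n)
    (hW : ∀ i < N, ∀ t < N, h.A i t < p) :
    WP input N C (sampleUnits k n D N) sampleProg (fun h' =>
      Agree 13 h h' ∧ h'.pos = (j + 1) * n ∧ (∀ i < N, ∀ t < N, h'.A i t < p) ∧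
      ∀ w, w ∈ Submodule.span (ZMod p) (Set.range (rows p N h')) ↔
        w ∈ Submodule.span (ZMod p) (Set.range (rows p N h)) ∧
          ∑ t : Fin N, w t * inputVec p k n D input j t = 0) h := by
  have hp : 1 < p := (Fact.out : p.Prime).one_lt
  refine WP.seq ((readProg_spec hC hN H).mono le_rfl ?_)
  rintro h1 ⟨ag1, pos1, row1, hY0, hY⟩
  have P1 := H.agree ag1 (by norm_num)
  have hdig : ∀ s ≤ n * k, h1.A (N + 2) s = inputDigit p k n input j s := by
    rintro (_ | s) hs
    · exact hY0
    · rw [hY s hs, hpos]; rfl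
  refine WP.seq ((monomialProg_spec hC hC' hp hN P1 ?_).mono le_rfl ?_)
  · rintro s hs
    rw [hdig s hs]
    cases s with
    | zero => exact hp
    | succ s => exact Nat.mod_lt _ (by omega)
  rintro h2 ⟨ag2, pos2, row2, hV⟩
  have P2 := P1.agree ag2 (by norm_num)
  have hW2 : ∀ i < N, ∀ t, h2.A i t = h.A i t := fun i hi t => by
    rw [row2 i t (by omega), row1 i t (by omega)]
  refine WP.seq ((productProg_spec hC hC' hp (by omega) P2 ?_).mono le_rfl ?_)
  · intro i hi t ht
    rcases hi.lt_or_eq with hi | rfl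
    · rw [hW2 i hi]; exact hW i hi t ht
    · exact (hV t ht).1
  rintro h3 ⟨ag3, pos3, row3, hA, h15, h14, h14', hpiv⟩
  have P3 := P2.agree ag3 (by norm_num)
  have hW3 : ∀ i < N, ∀ t, h3.A i t = h.A i t := fun i hi t => by
    rw [row3 i t (by omega), hW2 i hi]
  refine (eliminateProg_spec hC hC' P3 (fun i hi t ht => by rw [hW3 i hi]; exact hW i hi t ht) h15
    h14).mono le_rfl ?_
  rintro h4 ⟨ag4, pos4, hA4⟩
  refine ⟨((ag1.trans ag2).trans ag3).trans ag4, ?_, fun i hi t ht => ?_, fun w => ?_⟩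
  · rw [pos4, pos3, pos2, pos1, hpos]; ring
  · rw [hA4 i hi t ht]; exact Nat.mod_lt _ (by omega)
  · have e : rows p N h4 = fun i => (h3.σ 14 : ZMod p) • rows p N h i -
        (h3.A (N + 1) i : ZMod p) • rows p N h ⟨h3.σ 15, h15⟩ := by
      ext i t
      have h1 := (hA i i.2).1.le
      simp only [rows, Pi.sub_apply, Pi.smul_apply, smul_eq_mul, hA4 i i.2 t t.2, hW3 i i.2,
        hW3 _ h15, ZMod.natCast_mod, Nat.cast_add, Nat.cast_mul, Nat.cast_sub h1,
        ZMod.natCast_self]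
      ring
    rw [e]
    refine mem_span_eliminate_iff _ _ _ (fun i => ?_) ?_ _ ?_ w
    · rw [(hA i i.2).2, Finset.sum_range]
      refine Finset.sum_congr rfl fun t _ => ?_
      rw [hW2 i i.2, (hV t t.2).2]
      congr 1
      refine Finset.prod_congr rfl fun l _ => ?_
      rw [hdig _ (Nat.lt_succ_iff.1 (Nat.mod_lt _ (Nat.succ_pos _)))]
    · rw [Ne, ZMod.natCast_eq_zero_iff]
      exact Nat.not_dvd_of_pos_of_lt (Nat.pos_of_ne_zero h14') h14
    · refine hpiv.imp (fun h => by rw [h]) fun h i => by rw [h i i.2, Nat.cast_zero]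

theorem initProg_spec (hC : (N + 3) * N + 40 ≤ C) (H : Params p k n D N h)
    (hA : ∀ i t, h.A i t = 0) :
    WP input N C (N * (6 + 3) + 2) initProg (fun h' => Agree 12 h h' ∧ h'.pos = h.pos ∧
      ∀ i < N, ∀ t < N, h'.A i t = if i = t then 1 else 0) h := by
  refine WP.loop (m := N) (by omega) (by norm_num) (by norm_num) H.r7 (fun j h' =>
    Agree 12 h h' ∧ h'.pos = h.pos ∧
      ∀ i < N, ∀ t < N, h'.A i t = if i = t ∧ j ≤ i then 1 else 0) ?_ ?_ ?_
  · refine ⟨(Agree.refl _ _).set le_rfl _, rfl, fun i hi t _ => ?_⟩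
    rw [if_neg (by omega)]
    exact hA i t
  · rintro j hj h' - ⟨hag, hpos, hA'⟩
    have P := H.agree hag le_rfl
    refine (WP.block hC _ ?_).mono le_rfl fun _ => id
    simp [blockPre, Ins.pre, P.r4, P.r7, hj]
    refine ⟨by omega, (hag.set le_rfl _).setA _ _ _, hpos, fun i hi t ht => ?_⟩
    rw [hA' i hi t ht]
    split_ifs <;> first | rfl | omega
  · rintro h' - ⟨hag, hpos, hA'⟩
    exact ⟨hag, hpos, fun i hi t ht => by simpa using hA' i hi t ht⟩

theorem outputProg_spec (hC : (N + 3) * N + 40 ≤ C) (hN : 0 < N) (H : Params p k n D N h) :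
    WP input N C (6 + (N * (11 + 3) + 2 + 6)) outputProg (fun h' =>
      (h'.σ 0 = 0 ∧ ∃ i < N, h.A i 0 ≠ 0) ∨ (h'.σ 0 = 1 ∧ ∀ i < N, h.A i 0 = 0)) h := by
  refine WP.seq ((WP.block hC _ ?_).mono le_rfl fun _ => id)
  simp only [blockPre, Ins.pre]
  refine ⟨by norm_num, by norm_num, WP.seq ?_⟩
  refine WP.loop (m := N) (by omega) (by norm_num) (by norm_num) (by simp [H.r7]) (fun j h' =>
    Agree 12 h h' ∧ h'.A = h.A ∧ ((h'.σ 12 = 0 ∧ ∃ i < N, h.A i 0 ≠ 0) ∨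
      (h'.σ 12 = 1 ∧ ∀ i < N, j ≤ i → h.A i 0 = 0))) ?_ ?_ ?_
  · exact ⟨((Agree.refl _ _).set le_rfl _).set (by norm_num) _, rfl,
      Or.inr ⟨by simp [H.r4], fun i hi hi' => by omega⟩⟩
  · rintro j hj h' - ⟨hag, hA, hout⟩
    have P := H.agree hag le_rfl
    refine (WP.block hC _ ?_).mono le_rfl fun _ => id
    simp [blockPre, Ins.pre, P.r7, P.r11, hA]
    refine ⟨hN, by omega, ?_, ?_⟩
    · exact (((hag.set (by norm_num) _).set (by norm_num) _).set le_rfl _)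
    · by_cases e : h.A j 0 = 0
      · simp only [e, if_true]
        rcases hout with ⟨h1, h2⟩ | ⟨h1, h2⟩
        · exact Or.inl ⟨fun _ => h1, h2⟩
        · refine Or.inr ⟨by simp [h1], fun i hi hij => ?_⟩
          rcases hij.lt_or_eq with h | rfl
          · exact h2 i hi h
          · exact e
      · exact Or.inl ⟨by simp [e], j, hj, e⟩
  · rintro h' - ⟨hag, hA, hout⟩
    refine (WP.block hC _ ?_).mono le_rfl fun _ => id
    simp [blockPre, Ins.pre]
    simpa using hout

/-- Process `R` characters and decide. -/
def mainProg : Prog := .seq initProg (.seq (loop 12 8 sampleProg) outputProg)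

/-- The identity matrix spans all forms, so after `i` samples the rows span exactly the forms
vanishing on the first `i` vectors. -/
theorem mainProg_spec [Fact p.Prime] (hC : (N + 3) * N + 40 ≤ C) (hC' : 2 * (p * p) + 40 ≤ C)
    (hN : n * k < N) (H : Params p k n D N h) {R : ℕ} (hR : h.σ 8 = R) (hpos : h.pos = 0)
    (hA : ∀ i t, h.A i t = 0) :
    WP input N C (N * (6 + 3) + 2 + (R * (sampleUnits k n D N + 3) + 2 +
      (6 + (N * (11 + 3) + 2 + 6)))) mainProg (fun h' =>
      (h'.σ 0 = 0 ∧ HasWitness p N R (inputVec p k n D input)) ∨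
      (h'.σ 0 = 1 ∧ ¬ HasWitness p N R (inputVec p k n D input))) h := by
  have hp : 1 < p := (Fact.out : p.Prime).one_lt
  refine WP.seq ((initProg_spec hC H hA).mono le_rfl ?_)
  rintro h1 ⟨ag1, pos1, hA1⟩
  have P1 := H.agree ag1 le_rfl
  refine WP.seq (WP.loop (m := R) (by omega) (by norm_num) (by norm_num)
    (by rw [ag1 8 (by norm_num), hR]) (fun j h' => ∃ i, i + j = R ∧ Agree 12 h h' ∧
      h'.pos = i * n ∧ (∀ i < N, ∀ t < N, h'.A i t < p) ∧
      ∀ w, w ∈ Submodule.span (ZMod p) (Set.range (rows p N h')) ↔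
        ∀ l < i, ∑ t : Fin N, w t * inputVec p k n D input l t = 0) ?_ ?_ ?_)
  · refine ⟨0, by omega, ag1.set le_rfl _, by simp [pos1, hpos], ?_, fun w => ?_⟩
    · intro i hi t ht
      rw [Abs.set_A, hA1 i hi t ht]
      split_ifs <;> omega
    · have e : rows p N (h1.set 12 R) = fun i => Pi.single i 1 := by
        ext i t
        simp only [rows, Abs.set_A, hA1 i i.2 t t.2, Pi.single_apply, Fin.ext_iff, eq_comm]
        split_ifs <;> simp
      simp only [Nat.not_lt_zero, false_imp_iff, implies_true, iff_true]
      rw [e, Submodule.mem_span_range_iff_exists_fun]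
      refine ⟨w, ?_⟩
      ext t
      simp [Pi.single_apply]
  · rintro j hj h' hj' ⟨i, hij, hag, hpos', hlt, hspan⟩
    have hag' : Agree 12 h (h'.set 12 j) := hag.set le_rfl _
    refine (sampleProg_spec hC hC' hN (H.agree hag' le_rfl) (j := i) hpos' hlt).mono le_rfl ?_
    rintro h'' ⟨hag'', hpos'', hlt'', hspan''⟩
    refine ⟨by simpa using hag'' 12 (by norm_num), i + 1, by omega,
      hag'.trans (hag''.mono (by norm_num)), hpos'', hlt'', fun w => ?_⟩
    rw [hspan'' w]
    have : rows p N (h'.set 12 j) = rows p N h' := rfl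
    rw [this, hspan w]
    constructor
    · rintro ⟨h1, h2⟩ l hl
      rcases Nat.lt_succ_iff_lt_or_eq.1 hl with h | rfl
      · exact h1 l h
      · exact h2
    · exact fun h => ⟨fun l hl => h l (by omega), h i (by omega)⟩
  · rintro h' - ⟨i, hi, hag, hpos', hlt, hspan⟩
    obtain rfl : i = R := by omega
    refine (outputProg_spec hC (by omega) (H.agree hag le_rfl)).mono le_rfl ?_
    rintro h'' (⟨h0, j, hj, hne⟩ | ⟨h0, hz⟩)
    · refine Or.inl ⟨h0, rows p N h' ⟨j, hj⟩, (hspan _).1 (Submodule.subset_span ⟨_, rfl⟩),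
        ⟨0, by omega⟩, rfl, ?_⟩
      rw [rows, Ne, ZMod.natCast_eq_zero_iff]
      exact Nat.not_dvd_of_pos_of_lt (Nat.pos_of_ne_zero hne) (hlt j hj 0 (by omega))
    · refine Or.inr ⟨h0, ?_⟩
      rintro ⟨w, hw, t, ht, hwt⟩
      -- If every spanning row has entry `0` at index `0`, so has every form in the span; in
      -- particular, no witness exists.
      have hle : Submodule.span (ZMod p) (Set.range (rows p N h')) ≤
          LinearMap.ker (LinearMap.proj (R := ZMod p) (φ := fun _ : Fin N => ZMod p) t) := by
        rw [Submodule.span_le]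
        rintro _ ⟨i, rfl⟩
        simp [rows, ht, hz i i.2]
      exact hwt (hle ((hspan w).2 hw))

end Specs

/-! ### Computing the parameters, and the total running time -/

section Setup

variable {input : ℕ → ℕ} {p k n c D N C : ℕ} {h : Abs}

theorem setupProg_spec (hp : 0 < p) (hc : 0 < c) (hD : D = p ^ k - 1) (hN : N = (n * k + 1) ^ D)
    (hnk : n * k < N) (hC : (N + 3) * N + 40 ≤ C)
    (hC' : p ^ k + N * p + c * (2 ^ D * (N * p + 2)) + 40 ≤ C)
    (h0 : h.σ 0 = p) (h1 : h.σ 1 = k) (h2 : h.σ 2 = n) (h3 : h.σ 3 = c) (h11 : h.σ 11 = 0) :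
    WP input N C (11 + (k * (6 + 3) + 2 + (21 + (D * (6 + 3) + 2 + (26 + (D * (6 + 3) + 2 + 6))))))
      setupProg (fun h' => Params p k n D N h' ∧ h'.σ 8 = c * (2 ^ D * (N * p + 2)) ∧
        h'.pos = h.pos ∧ h'.A = h.A) h := by
  have hR : 2 ^ D * (N * p + 2) ≤ c * (2 ^ D * (N * p + 2)) := Nat.le_mul_of_pos_left _ hc
  refine WP.seq ((WP.block hC _ ?_).mono le_rfl fun _ => id)
  simp only [blockPre, Ins.pre]
  refine ⟨by norm_num, by norm_num, WP.seq ?_⟩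
  refine WP.loop (m := k) (by omega) (by norm_num) (by norm_num) (by simp [h1]) (fun j h' =>
    ∃ e, e + j = k ∧ Agree 4 h h' ∧ h'.pos = h.pos ∧ h'.A = h.A ∧ h'.σ 4 = 1 ∧ h'.σ 11 = 0 ∧
      h'.σ 6 = p ^ e) ?_ ?_ ?_
  · exact ⟨0, by omega, (((Agree.refl _ _).set le_rfl _).set (by norm_num) _).set (by norm_num) _,
      rfl, rfl, by simp, by simp [h11], by simp⟩
  · rintro j hj h' - ⟨e, he, hag, hpos, hA, h4, h11, h6⟩
    refine (WP.block hC _ ?_).mono le_rfl fun _ => id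
    have hcost := Op.cost_le .mul (p ^ e) p
    have hle : p ^ (e + 1) ≤ p ^ k := Nat.pow_le_pow_right hp (by omega)
    rw [pow_succ] at hle
    simp only [Op.value] at hcost
    simp [blockPre, Ins.pre, Op.value, h6, h4, h11, (hag 0 (by norm_num)).trans h0]
    exact ⟨by omega, e + 1, by omega, (hag.set (by norm_num) _).set (by norm_num) _, hpos, hA,
      by rw [pow_succ]⟩
  rintro g - ⟨e, he, hag, hpos, hA, h4, h11, h6⟩
  obtain rfl : e = k := by omega
  refine WP.seq ((WP.block hC _ ?_).mono le_rfl fun _ => id)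
  have hcost := Op.cost_le .mul n e
  have hcost' := Op.cost_add_le (n * e) 1
  have hNN : N ≤ (N + 3) * N := Nat.le_mul_of_pos_left _ (by omega)
  simp only [Op.value] at hcost
  simp [blockPre, Ins.pre, Op.value, Op.cost_sub, h6, h4, (hag 1 (by norm_num)).trans h1,
    (hag 2 (by norm_num)).trans h2]
  refine ⟨by omega, by omega, by omega, WP.seq ?_⟩
  refine WP.loop (m := D) (by omega) (by norm_num) (by norm_num) (by simp [hD]) (fun j h' =>
    ∃ l, l + j = D ∧ Agree 4 h h' ∧ h'.pos = h.pos ∧ h'.A = h.A ∧ h'.σ 4 = 1 ∧ h'.σ 11 = 0 ∧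
      h'.σ 6 = D ∧ h'.σ 5 = n * e + 1 ∧ h'.σ 7 = (n * e + 1) ^ l) ?_ ?_ ?_
  · refine ⟨0, by omega, ?_, hpos, hA, by simp [h4], by simp [h11], by simp [hD], by simp, by simp⟩
    exact ((((hag.set (by norm_num) _).set (by norm_num) _).set (by norm_num) _).set
      (by norm_num) _).set (by norm_num) _
  · rintro j hj h' - ⟨l, hl, hag, hpos, hA, h4, h11, h6, h5, h7⟩
    refine (WP.block hC _ ?_).mono le_rfl fun _ => id
    have hcost := Op.cost_le .mul ((n * e + 1) ^ l) (n * e + 1)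
    have hle : (n * e + 1) ^ (l + 1) ≤ N := hN ▸ Nat.pow_le_pow_right (by omega) (by omega)
    rw [pow_succ] at hle
    simp only [Op.value] at hcost
    simp [blockPre, Ins.pre, Op.value, h7, h6, h5, h4, h11]
    exact ⟨by omega, l + 1, by omega, (hag.set (by norm_num) _).set (by norm_num) _, hpos, hA,
      by rw [pow_succ]⟩
  rintro g' - ⟨l, hl, hag, hpos, hA, h4, h11, h6, h5, h7⟩
  obtain rfl : l = D := by omega
  rw [← hN] at h7
  refine WP.seq ((WP.block hC _ ?_).mono le_rfl fun _ => id)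
  have hcost := Op.cost_le .mul N p
  have c1 := Op.cost_add_le N 1
  have c2 := Op.cost_add_le (N + 1) 1
  have c3 := Op.cost_add_le (N * p) 2
  simp only [Op.value] at hcost
  simp [blockPre, Ins.pre, Op.value, h7, h4, (hag 0 (by norm_num)).trans h0]
  refine ⟨by omega, by omega, by omega, by omega, WP.seq ?_⟩
  refine WP.loop (m := l) (by omega) (by norm_num) (by norm_num) (by simp [h6]) (fun j h' =>
    ∃ i, i + j = l ∧ Agree 4 h h' ∧ h'.pos = h.pos ∧ h'.A = h.A ∧ h'.σ 4 = 1 ∧ h'.σ 11 = 0 ∧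
      h'.σ 6 = l ∧ h'.σ 5 = n * e + 1 ∧ h'.σ 7 = N ∧ h'.σ 9 = N + 1 ∧ h'.σ 10 = N + 2 ∧
      h'.σ 13 = 2 ∧ h'.σ 8 = 2 ^ i * (N * p + 2)) ?_ ?_ ?_
  · refine ⟨0, by omega, ?_, hpos, hA, by simp [h4], by simp [h11], by simp [h6], by simp [h5],
      by simp [h7], by simp, by simp, by simp, by simp⟩
    exact (((((hag.set (by norm_num) _).set (by norm_num) _).set (by norm_num) _).set
      (by norm_num) _).set (by norm_num) _).set (by norm_num) _
  · rintro j hj h' - ⟨i, hi, hag, hpos, hA, h4, h11, h6, h5, h7, h9, h10, h13, h8⟩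
    refine (WP.block hC _ ?_).mono le_rfl fun _ => id
    have hcost := Op.cost_le .mul (2 ^ i * (N * p + 2)) 2
    have hle : 2 ^ (i + 1) * (N * p + 2) ≤ 2 ^ l * (N * p + 2) :=
      Nat.mul_le_mul_right _ (Nat.pow_le_pow_right (by norm_num) (by omega))
    have e1 : 2 ^ i * (N * p + 2) * 2 = 2 ^ (i + 1) * (N * p + 2) := by ring
    simp only [Op.value] at hcost
    simp [blockPre, Ins.pre, Op.value, h4, h5, h6, h7, h8, h9, h10, h11, h13]
    exact ⟨by omega, i + 1, by omega, (hag.set (by norm_num) _).set (by norm_num) _, hpos, hA, e1⟩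
  rintro g'' - ⟨i, hi, hag, hpos, hA, h4, h11, h6, h5, h7, h9, h10, h13, h8⟩
  obtain rfl : i = l := by omega
  refine (WP.block hC _ ?_).mono le_rfl fun _ => id
  have hcost := Op.cost_le .mul (2 ^ i * (N * p + 2)) c
  simp only [Op.value] at hcost
  have hag' : Agree 4 h (g''.set 8 (2 ^ i * (N * p + 2) * c)) := hag.set (by norm_num) _
  rw [mul_comm _ c] at hcost hag'
  simp [blockPre, Ins.pre, Op.value, h8, (hag 3 (by norm_num)).trans h3, mul_comm _ c]
  exact ⟨by omega, ⟨(hag' 0 (by norm_num)).trans h0, (hag' 1 (by norm_num)).trans h1,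
    (hag' 2 (by norm_num)).trans h2, by simp [h4], by simp [h5], by simp [h6], by simp [h7],
    by simp [h9], by simp [h10], by simp [h11]⟩, hpos, hA⟩

/-- The decision algorithm. -/
def decideProg : Prog := .seq setupProg mainProg

/-- The decision algorithm halts with the output that tells whether there is a witness. -/
theorem decideProg_runs [Fact p.Prime] (hk : 0 < k) (hc : 0 < c) (hD : D = p ^ k - 1)
    (hN : N = (n * k + 1) ^ D) {R : ℕ} (hR : R = c * (2 ^ D * (N * p + 2))) :
    ∃ out t, Runs decideProg p k n c input out t ∧
      t ≤ ((N + 3) * N + 2 * (p * p) + p ^ k + N * p + R + 40) *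
          (11 + (k * (6 + 3) + 2 + (21 + (D * (6 + 3) + 2 + (26 + (D * (6 + 3) + 2 + 6)))))) +
        ((N + 3) * N + 2 * (p * p) + 40) * (N * (6 + 3) + 2 +
          (R * (sampleUnits k n D N + 3) + 2 + (6 + (N * (11 + 3) + 2 + 6)))) ∧
      ((out = 0 ∧ HasWitness p N R (inputVec p k n D input)) ∨
        (out = 1 ∧ ¬ HasWitness p N R (inputVec p k n D input))) := by
  have hp : 1 < p := (Fact.out : p.Prime).one_lt
  have hD1 : D ≠ 0 := by
    have := Nat.one_lt_pow hk.ne' hp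
    omega
  have hnk : n * k < N := by
    rw [hN]
    exact (Nat.lt_succ_self _).trans_le (Nat.le_self_pow hD1 _)
  have hrep : Rep N ⟨initMem p k n c, fun _ _ => 0, 0⟩ ⟨initMem p k n c, 0⟩ := by
    refine ⟨fun _ _ => rfl, fun i t _ => ?_, rfl⟩
    rw [add_comm]; rfl
  obtain ⟨s, t, h, he, ht, hr, hP, h8, hpos, hA⟩ := setupProg_spec (input := input)
    (C := (N + 3) * N + 2 * (p * p) + p ^ k + N * p + R + 40) (by omega) hc hD hN hnk (by omega)
    (by omega) rfl rfl rfl rfl rfl _ hrep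
  -- The price per unit drops `R`, which only the setup has to create. Since `R` is already a factor
  -- of the number of units, keeping it in the price would make the bound quadratic in `c`.
  obtain ⟨s', t', h', he', ht', hr', hout⟩ := mainProg_spec (input := input)
    (C := (N + 3) * N + 2 * (p * p) + 40) (by omega) (by omega) hnk hP (R := R) (by rw [h8, hR])
    hpos (fun _ _ => by rw [hA]) _ hr
  refine ⟨s'.mem 0, t + t', ⟨s', he.seq he', rfl⟩, Nat.add_le_add ht ht', ?_⟩
  rwa [hr'.reg 0 (by norm_num)]

end Setup

/-- One number `X` dominates all parameters except `c`. The assumption `16 ≤ X` lets each numerical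
constant be absorbed by extra factors `X`, while `c` is kept linear. -/
theorem steps_le {X p k n c D N R P : ℕ} (hX : 16 ≤ X) (hc : 1 ≤ c) (hp : p ≤ X) (hk : k ≤ X)
    (hn : n ≤ X) (hD : D ≤ X) (hN : N ≤ X) (hP : P ≤ X) (h2 : 2 ^ D ≤ X)
    (hR : R = c * (2 ^ D * (N * p + 2))) :
    ((N + 3) * N + 2 * (p * p) + P + N * p + R + 40) *
          (11 + (k * (6 + 3) + 2 + (21 + (D * (6 + 3) + 2 + (26 + (D * (6 + 3) + 2 + 6)))))) +
        ((N + 3) * N + 2 * (p * p) + 40) * (N * (6 + 3) + 2 +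
          (R * (sampleUnits k n D N + 3) + 2 + (6 + (N * (11 + 3) + 2 + 6)))) ≤ c * X ^ 14 := by
  have hX2 : 16 * X ≤ X ^ 2 := by nlinarith
  have hX3 : 16 * X ^ 2 ≤ X ^ 3 := by nlinarith
  have hX4 : 16 * X ^ 3 ≤ X ^ 4 := by nlinarith [pow_pos (show 0 < X by omega) 3]
  have mono : ∀ {a b : ℕ}, a ≤ b → X ^ a ≤ X ^ b := fun h => Nat.pow_le_pow_right (by omega) h
  have hR' : R ≤ c * X ^ 4 := by
    rw [hR]
    refine Nat.mul_le_mul_left _ ?_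
    calc 2 ^ D * (N * p + 2) ≤ X * (X * X + 2) := by gcongr
      _ = X ^ 3 + 2 * X := by ring
      _ ≤ X ^ 4 := by omega
  have hC : (N + 3) * N + 2 * (p * p) + 40 ≤ X ^ 3 := by
    calc (N + 3) * N + 2 * (p * p) + 40 ≤ (X + 3) * X + 2 * (X * X) + 40 := by gcongr
      _ = 3 * X ^ 2 + 3 * X + 40 := by ring
      _ ≤ X ^ 3 := by omega
  have hC' : (N + 3) * N + 2 * (p * p) + P + N * p + R + 40 ≤ c * X ^ 5 := by
    have h1 : N * p ≤ X ^ 2 := by rw [pow_two]; gcongr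
    have h2 : c * X ^ 5 = c * X ^ 4 * X := by ring
    have h3 : X ^ 4 ≤ c * X ^ 4 := Nat.le_mul_of_pos_left _ hc
    have h4 : c * X ^ 4 * 16 ≤ c * X ^ 4 * X := Nat.mul_le_mul_left _ hX
    omega
  have hU : 11 + (k * (6 + 3) + 2 + (21 + (D * (6 + 3) + 2 + (26 + (D * (6 + 3) + 2 + 6))))) ≤
      X ^ 3 := by omega
  have hS : sampleUnits k n D N + 3 ≤ X ^ 4 := by
    have h1 : n * (6 + (k * (21 + 3) + 2) + 3) ≤ X * (6 + (X * (21 + 3) + 2) + 3) := by gcongr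
    have h2 : N * ((11 + (D * (26 + 3) + 2 + 6)) + 3) ≤ X * ((11 + (X * (26 + 3) + 2 + 6)) + 3) := by
      gcongr
    have h3 : N * ((6 + (N * (26 + 3) + 2 + 16)) + 3) ≤ X * ((6 + (X * (26 + 3) + 2 + 16)) + 3) := by
      gcongr
    have h4 : N * ((6 + (N * (41 + 3) + 2)) + 3) ≤ X * ((6 + (X * (41 + 3) + 2)) + 3) := by gcongr
    ring_nf at h1 h2 h3 h4
    unfold sampleUnits
    ring_nf
    omega
  have hM : N * (6 + 3) + 2 + (R * (sampleUnits k n D N + 3) + 2 + (6 + (N * (11 + 3) + 2 + 6))) ≤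
      c * X ^ 9 := by
    have h1 : R * (sampleUnits k n D N + 3) ≤ c * X ^ 8 := by
      calc _ ≤ c * X ^ 4 * X ^ 4 := by gcongr
        _ = _ := by ring
    have h2 : c * X ^ 9 = c * X ^ 8 * X := by ring
    have h3 : c * X ^ 8 * 16 ≤ c * X ^ 8 * X := Nat.mul_le_mul_left _ hX
    have h4 : X ^ 8 ≤ c * X ^ 8 := Nat.le_mul_of_pos_left _ hc
    have h5 : X ^ 2 ≤ X ^ 8 := mono (by norm_num)
    omega
  calc _ ≤ c * X ^ 5 * X ^ 3 + X ^ 3 * (c * X ^ 9) :=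
        Nat.add_le_add (Nat.mul_le_mul hC' hU) (Nat.mul_le_mul hC hM)
    _ = c * X ^ 8 + c * X ^ 12 := by ring
    _ ≤ c * X ^ 13 + c * X ^ 13 := by
        gcongr <;> omega
    _ = c * X ^ 13 * 2 := by ring
    _ ≤ c * X ^ 13 * X := Nat.mul_le_mul_left _ (by omega)
    _ = c * X ^ 14 := by ring

/-! ### From input streams to sampled characters -/

section Streams

variable {p k n : ℕ} [Fact p.Prime] [NeZero n]

theorem inputVec_charStream (ζ : ℂ) (b : Module.Basis (Fin n) (ZMod (p ^ k)) (Grp p k n))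
    (s : ℕ → Chars p k n) :
    inputVec p k n (p ^ k - 1) (charStream ζ b s) = fun j => charVec ζ b (s j) := by
  ext j t
  refine Finset.prod_congr rfl fun l _ => ?_
  have hlt := Nat.mod_lt (t / (n * k + 1) ^ l) (Nat.succ_pos (n * k))
  generalize t / (n * k + 1) ^ l % (n * k + 1) = a at hlt
  cases a with
  | zero => simp [inputDigit, digitFun]
  | succ a =>
    have ha : a < n * k := by omega
    have hak : a / k < n := Nat.div_lt_of_lt_mul (by rwa [mul_comm])
    simp only [inputDigit, digitFun, dif_pos ha, charDigits, charStream]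
    have e1 : (j * n + a / k) / n = j := by
      rw [add_comm, Nat.add_mul_div_right _ _ (NeZero.pos n), Nat.div_eq_of_lt hak, zero_add]
    have e2 : Fin.ofNat n (j * n + a / k) = Fin.divNat (⟨a, ha⟩ : Fin (n * k)) := by
      ext
      simp [Nat.mod_eq_of_lt hak]
    rw [e1, e2]
    rfl

theorem decidesInTime_decideProg {c : ℝ} (hk : 1 ≤ k) (hc : 1 ≤ c) :
    DecidesInTime decideProg p k n c (c * ((p * n * k : ℕ) : ℝ) ^ (15 * (2 * p) ^ k)) := by
  intro ζ b hζ
  have hp : 2 ≤ p := (Fact.out : p.Prime).two_le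
  have hn : 1 ≤ n := NeZero.pos n
  have hcc : 1 ≤ ⌈c⌉₊ := Nat.one_le_ceil_iff.2 (by linarith)
  set D := p ^ k - 1 with hD
  set N := (n * k + 1) ^ D with hN
  set R := ⌈c⌉₊ * (2 ^ D * (N * p + 2)) with hR
  have run := fun s : ℕ → Chars p k n =>
    decideProg_runs (input := charStream ζ b s) (c := ⌈c⌉₊) hk hcc hD hN hR
  simp only [hD, inputVec_charStream] at run
  rw [← hD] at run
  refine ⟨fun s => ?_, fun μ => ⟨?_, fun hμ => ?_⟩⟩
  · obtain ⟨out, t, hrun, ht, -⟩ := run s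
    refine ⟨out, t, hrun, ?_⟩
    set B := p * n * k with hB
    -- Since `B ≥ 2`, this dominates `2 ^ D`, `p ^ k` and `D`; since `n * k + 1 ≤ B`, it dominates
    -- `N`. The base `2 * p` makes the exponent at least `4`, whence `X ≥ 16`.
    set X := B ^ (2 * p) ^ k with hX
    have hnk : 1 ≤ n * k := Nat.mul_pos hn hk
    have hBnk : B = p * (n * k) := mul_assoc _ _ _
    have hB2 : 2 ≤ B := by rw [hBnk]; nlinarith
    have hpB : p ≤ B := by rw [hBnk]; exact Nat.le_mul_of_pos_right _ hnk
    have hnkB : n * k + 1 ≤ B := by rw [hBnk]; nlinarith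
    have hnB : n ≤ B := (Nat.le_mul_of_pos_right _ hk).trans (by omega)
    have hkB : k ≤ B := (Nat.le_mul_of_pos_left _ hn).trans (by omega)
    have hpE : p ^ k ≤ (2 * p) ^ k := Nat.pow_le_pow_left (by omega) k
    have hDE : D ≤ (2 * p) ^ k := by omega
    have hE4 : 4 ≤ (2 * p) ^ k := (by omega : 4 ≤ 2 * p).trans (Nat.le_self_pow (by omega) _)
    have hBX : B ≤ X := Nat.le_self_pow (by omega) _
    have h2X : 2 ^ (2 * p) ^ k ≤ X := Nat.pow_le_pow_left hB2 _
    have hEX : (2 * p) ^ k ≤ X := Nat.lt_two_pow_self.le.trans h2X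
    have hfin := steps_le (X := X) (p := p) (k := k) (n := n) (c := ⌈c⌉₊) (D := D) (N := N) (R := R)
      (P := p ^ k) ((by norm_num : 16 ≤ 2 ^ 4).trans
        ((Nat.pow_le_pow_right (by norm_num) hE4).trans h2X)) hcc (hpB.trans hBX) (hkB.trans hBX)
      (hnB.trans hBX) (hDE.trans hEX)
      ((Nat.pow_le_pow_left hnkB D).trans (Nat.pow_le_pow_right (by omega) hDE)) (hpE.trans hEX)
      ((Nat.pow_le_pow_right (by norm_num) hDE).trans h2X) hR
    have h1 : (t : ℝ) ≤ ⌈c⌉₊ * (X : ℝ) ^ 14 := by exact_mod_cast ht.trans hfin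
    -- Rounding costs one more factor: `⌈c⌉ ≤ c + 1 ≤ 2 * c ≤ c * X`. This turns the exponent `14`
    -- into `15`.
    have h2 : (⌈c⌉₊ : ℝ) ≤ c * X := by
      have h3 := (Nat.ceil_lt_add_one (by linarith : (0 : ℝ) ≤ c)).le
      have h4 : (2 : ℝ) ≤ X := by exact_mod_cast hB2.trans hBX
      nlinarith
    calc (t : ℝ) ≤ _ := h1
      _ ≤ c * X * (X : ℝ) ^ 14 := by gcongr
      _ = c * (X : ℝ) ^ 15 := by ring
      _ = _ := by rw [hX, Nat.cast_pow, ← pow_mul, mul_comm 15]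
  · rintro ⟨u, hu⟩
    refine sampleLaw_eq_one_of_forall (R := R) hu.1 fun s hs => ?_
    obtain ⟨out, t, hrun, -, ⟨rfl, -⟩ | ⟨-, hw⟩⟩ := run s
    · exact ⟨t, hrun⟩
    · exact absurd (hasWitness_of_ne_one hζ b u R s hs) hw
  · refine two_thirds_le_sampleLaw hζ b hc hμ hN hR fun s hs => ?_
    obtain ⟨out, t, hrun, -, ⟨-, hw⟩ | ⟨rfl, -⟩⟩ := run s
    · exact absurd hw hs
    · exact ⟨t, hrun⟩

end Streams

end RandomLinearDisequations

open RandomLinearDisequations in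
theorem mainTheorem1 :
    ∃ (P : Prog) (K : ℕ),
      (∀ (p k n : ℕ) [Fact p.Prime] [NeZero n] (c : ℝ), 1 ≤ k → 1 ≤ c →
        DecidesInTime P p k n c (c * ((p * n * k : ℕ) : ℝ) ^ (K * (2 * p) ^ k))) ∧
      (∀ (p k : ℕ) [Fact p.Prime] (c : ℝ), 1 ≤ k → 1 ≤ c →
        ∃ q : Polynomial ℕ, ∀ (n : ℕ) [NeZero n],
          DecidesInTime P p k n c ((q.eval n : ℕ) : ℝ)) := by
  -- For fixed `p`, `k` and `c` the exponent is constant, so the general bound, with `c` rounded up,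
  -- is the value at `n` of the polynomial `⌈c⌉ * (p * k * X) ^ (15 * (2 * p) ^ k)`.
  refine ⟨decideProg, 15, fun p k n _ _ c hk hc => decidesInTime_decideProg hk hc,
    fun p k _ c hk hc => ⟨Polynomial.C ⌈c⌉₊ *
      (Polynomial.C (p * k) * Polynomial.X) ^ (15 * (2 * p) ^ k), fun n _ ζ b hζ => ?_⟩⟩
  obtain ⟨h1, h2⟩ := decidesInTime_decideProg (p := p) (k := k) (n := n) hk hc ζ b hζ
  refine ⟨fun s => ?_, h2⟩
  obtain ⟨out, t, hrun, ht⟩ := h1 s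
  refine ⟨out, t, hrun, ht.trans ?_⟩
  simp only [Polynomial.eval_mul, Polynomial.eval_pow, Polynomial.eval_C, Polynomial.eval_X,
    Nat.cast_mul, Nat.cast_pow, mul_right_comm (p : ℝ) (n : ℝ)]
  gcongr
  exact Nat.le_ceil c
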